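/- Let $T$ be a left-invariant $(0,2)$-tensor field on the Lie group $SO(3)$, with Lie algebra $\mathfrak{so}(3)$. A *solution* is a pair $(g,c)$ consisting of a left-invariant Riemannian metric $g$ on $SO(3)$ and a constant $c>0$ such that $\mathrm{Ric}(g)=cT$, where $\mathrm{Ric}(g)$ is the Ricci curvature of $g$. If $(g,c)$ is a solution, so is $(kg,c)$ for every $k>0$; solutions are counted up to this scaling of $g$. A *Milnor basis* is a basis $V_1,V_2,V_3$ of $\mathfrak{so}(3)$ with $[V_i,V_j]=\sum_{k=1}^3\epsilon_{ijk}\lambda_kV_k$ and $\lambda_1=\lambda_2=\lambda_3=2$, where $\epsilon_{ijk}$ is the Levi-Civita symbol. We write $T=\mathrm{diag}(T_1,T_2,T_3)$ in this basis if $T(V_i,V_j)=\delta_{ij}T_i$ for all $i,j$. For real $T_1,T_2,T_3$ put $$\bar f(p)=2p^3+(T_1+T_2+T_3)p^2-T_1T_2T_3 .$$ Then a solution exists if and only if there are a Milnor basis and numbers $T_1,T_2,T_3$ such that $T=\mathrm{diag}(T_1,T_2,T_3)$ in that basis and one of the following conditions holds: (i) $T_1\ge T_2\ge T_3>0$; (ii)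 $T_1>0$ and $T_2=T_3=0$; (iii) $T_1>0$, $T_3\le T_2<0$, and either $\bar f\left(-\frac{T_1+T_2+T_3}{3}\right)\ge 0$ and $-\frac{T_1+T_2+T_3}{3}<0$, or else $\bar f(-T_1)>0$. Moreover, whenever $T=\mathrm{diag}(T_1,T_2,T_3)$ in a Milnor basis: * In case (i) there is exactly one solution $(g,c)$ up to scaling of $g$ (in particular $c$ is unique). * In case (ii) there are infinitely many solutions, pairwise different up to scaling of $g$, and every solution has $c=8/T_1$. * In case (iii) there is exactly one solution up to scaling of $g$, unless $\bar f(-T_1)<0$, $-\frac{T_1+T_2+T_3}{3}<0$ and $\bar f\left(-\frac{T_1+T_2+T_3}{3}\right)>0$; in that exceptional case there are exactly two solutions $(g_1,c_1)$ and $(g_2,c_2)$ up to scaling of the metrics, and $c_1\ne c_2$. -/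

import Mathlib

open scoped Manifold ContDiff Topology

noncomputable section

/-- The group `SO(3)` of orthogonal real `3 × 3` matrices of determinant one. -/
abbrev SO3 : Type := Matrix.specialOrthogonalGroup (Fin 3) ℝ

/-- Euclidean three-space, the model space of `SO(3)`. -/
abbrev E3 : Type := EuclideanSpace ℝ (Fin 3)

namespace SO3

/-- The rotation with Gibbs vector `s`: the rotation about the axis `s` by the angle
`2 arctan ‖s‖`. -/
def rotMatrix (s : E3) : Matrix (Fin 3) (Fin 3) ℝ :=
  (1 + (s 0 ^ 2 + s 1 ^ 2 + s 2 ^ 2))⁻¹ •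
    !![1 + s 0 ^ 2 - s 1 ^ 2 - s 2 ^ 2, 2 * (s 0 * s 1 - s 2), 2 * (s 0 * s 2 + s 1);
       2 * (s 0 * s 1 + s 2), 1 - s 0 ^ 2 + s 1 ^ 2 - s 2 ^ 2, 2 * (s 1 * s 2 - s 0);
       2 * (s 0 * s 2 - s 1), 2 * (s 1 * s 2 + s 0), 1 - s 0 ^ 2 - s 1 ^ 2 + s 2 ^ 2]

/-- The Gibbs vector of a matrix (meaningful for rotations with `1 + tr M ≠ 0`). -/
def gibbs (M : Matrix (Fin 3) (Fin 3) ℝ) : E3 :=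
  !₂[(M 2 1 - M 1 2) / (1 + M.trace), (M 0 2 - M 2 0) / (1 + M.trace),
    (M 1 0 - M 0 1) / (1 + M.trace)]

theorem den_pos (s : E3) : 0 < 1 + (s 0 ^ 2 + s 1 ^ 2 + s 2 ^ 2) := by positivity

theorem mem_iff (M : Matrix (Fin 3) (Fin 3) ℝ) :
    M ∈ Matrix.specialOrthogonalGroup (Fin 3) ℝ ↔ M * M.transpose = 1 ∧ M.det = 1 := by
  rw [Matrix.mem_specialOrthogonalGroup_iff, Matrix.mem_orthogonalGroup_iff]

theorem rotMatrix_mem (s : E3) : rotMatrix s ∈ Matrix.specialOrthogonalGroup (Fin 3) ℝ := by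
  have h := (den_pos s).ne'
  rw [mem_iff]
  constructor
  · ext i j
    fin_cases i <;> fin_cases j <;>
      simp [rotMatrix, Matrix.mul_apply, Fin.sum_univ_three] <;> field_simp <;> ring
  · simp [rotMatrix, Matrix.det_fin_three]
    field_simp
    ring

/-- The rotation with Gibbs vector `s` as an element of `SO(3)`. -/
def rot (s : E3) : SO3 := ⟨rotMatrix s, rotMatrix_mem s⟩

theorem trace_rot (s : E3) :
    1 + (rotMatrix s).trace = 4 / (1 + (s 0 ^ 2 + s 1 ^ 2 + s 2 ^ 2)) := by
  have h := (den_pos s).ne'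
  simp [rotMatrix, Matrix.trace, Fin.sum_univ_three]
  field_simp
  ring

theorem gibbs_rot (s : E3) : gibbs (rotMatrix s) = s := by
  have h := (den_pos s).ne'
  ext i
  rw [gibbs, trace_rot]
  fin_cases i <;> simp [rotMatrix] <;> field_simp <;> ring

theorem rot_gibbs {M : Matrix (Fin 3) (Fin 3) ℝ}
    (hM : M ∈ Matrix.specialOrthogonalGroup (Fin 3) ℝ) (ht : 1 + M.trace ≠ 0) :
    rotMatrix (gibbs M) = M := by
  obtain ⟨h1, h2⟩ := (mem_iff M).1 hM
  have h3 : M.transpose * M = 1 := mul_eq_one_comm.1 h1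
  have hadj : M.adjugate = M.transpose := by
    have := Matrix.mul_adjugate M
    rw [h2, one_smul] at this
    calc M.adjugate = M.transpose * M * M.adjugate := by rw [h3, one_mul]
      _ = M.transpose := by rw [mul_assoc, this, mul_one]
  have e := fun i j => congrFun (congrFun h1 i) j
  have e' := fun i j => congrFun (congrFun h3 i) j
  have a := fun i j => congrFun (congrFun hadj i) j
  have e00 := e 0 0
  have e11 := e 1 1
  have e22 := e 2 2
  have e01 := e 0 1
  have e02 := e 0 2
  have e12 := e 1 2
  have f00 := e' 0 0
  have f11 := e' 1 1
  have f22 := e' 2 2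
  have f01 := e' 0 1
  have f02 := e' 0 2
  have f12 := e' 1 2
  simp only [Matrix.mul_apply, Fin.sum_univ_three, Matrix.transpose_apply, Matrix.one_apply] at e00 e11 e22 e01 e02 e12 f00 f11 f22 f01 f02 f12
  simp [Matrix.adjugate_fin_three, Fin.forall_fin_succ] at a e00 e11 e22 e01 e02 e12 f00 f11 f22 f01 f02 f12
  have ht' : 1 + (M 0 0 + M 1 1 + M 2 2) ≠ 0 := by
    simpa [Matrix.trace, Fin.sum_univ_three] using ht
  obtain ⟨⟨b00, b01, b02⟩, ⟨b10, b11, b12⟩, b20, b21, b22⟩ := a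
  set t := 1 + (M 0 0 + M 1 1 + M 2 2) with htdef
  set p := M 2 1 - M 1 2 with hp
  set q := M 0 2 - M 2 0 with hq
  set r := M 1 0 - M 0 1 with hr
  have k : t ^ 2 + (p ^ 2 + q ^ 2 + r ^ 2) = 4 * t := by rw [hp, hq, hr, htdef]; linarith
  have k00 : t ^ 2 + p ^ 2 - q ^ 2 - r ^ 2 = 4 * t * M 0 0 := by rw [hp, hq, hr, htdef]; linarith
  have k11 : t ^ 2 - p ^ 2 + q ^ 2 - r ^ 2 = 4 * t * M 1 1 := by rw [hp, hq, hr, htdef]; linarith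
  have k22 : t ^ 2 - p ^ 2 - q ^ 2 + r ^ 2 = 4 * t * M 2 2 := by rw [hp, hq, hr, htdef]; linarith
  have k01 : 2 * (p * q - t * r) = 4 * t * M 0 1 := by rw [hp, hq, hr, htdef]; linarith
  have k10 : 2 * (p * q + t * r) = 4 * t * M 1 0 := by rw [hp, hq, hr, htdef]; linarith
  have k02 : 2 * (p * r + t * q) = 4 * t * M 0 2 := by rw [hp, hq, hr, htdef]; linarith
  have k20 : 2 * (p * r - t * q) = 4 * t * M 2 0 := by rw [hp, hq, hr, htdef]; linarith
  have k12 : 2 * (q * r - t * p) = 4 * t * M 1 2 := by rw [hp, hq, hr, htdef]; linarith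
  have k21 : 2 * (q * r + t * p) = 4 * t * M 2 1 := by rw [hp, hq, hr, htdef]; linarith
  have hs : 1 + (gibbs M 0 ^ 2 + gibbs M 1 ^ 2 + gibbs M 2 ^ 2) = 4 / t := by
    have : 1 + M.trace = t := by simp [htdef, Matrix.trace, Fin.sum_univ_three]
    simp only [gibbs, this, ← hp, ← hq, ← hr]
    simp
    field_simp
    linarith
  have g0 : gibbs M 0 = p / t := by
    simp [gibbs, htdef, Matrix.trace, Fin.sum_univ_three, hp]
  have g1 : gibbs M 1 = q / t := by
    simp [gibbs, htdef, Matrix.trace, Fin.sum_univ_three, hq]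
  have g2 : gibbs M 2 = r / t := by
    simp [gibbs, htdef, Matrix.trace, Fin.sum_univ_three, hr]
  rw [rotMatrix, hs, g0, g1, g2]
  ext i j
  fin_cases i <;> fin_cases j <;> simp <;> field_simp <;> linarith

theorem continuous_coe : Continuous (fun A : SO3 => (A : Matrix (Fin 3) (Fin 3) ℝ)) :=
  continuous_subtype_val

theorem contDiff_rotMatrix {n : WithTop ℕ∞} (i j : Fin 3) :
    ContDiff ℝ n (fun s : E3 => rotMatrix s i j) := by
  have h := fun s => (den_pos s).ne'
  have h' : ∀ k : Fin 3, ContDiff ℝ n (fun s : E3 => s k) := fun k => by fun_prop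
  have hd : ContDiff ℝ n (fun s : E3 => (1 + (s 0 ^ 2 + s 1 ^ 2 + s 2 ^ 2))⁻¹) :=
    ContDiff.inv (by fun_prop) h
  fin_cases i <;> fin_cases j <;> simp [rotMatrix] <;> exact hd.mul (by fun_prop)

theorem continuous_rot : Continuous rot := by
  refine Continuous.subtype_mk (continuous_matrix fun i j => ?_) _
  exact (contDiff_rotMatrix (n := 0) i j).continuous

theorem contMDiffAt_gibbs {n : WithTop ℕ∞} {F : Type*} [NormedAddCommGroup F] [NormedSpace ℝ F]
    {H : Type*} [TopologicalSpace H] {J : ModelWithCorners ℝ F H}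
    {N : Type*} [TopologicalSpace N] [ChartedSpace H N]
    {f : N → Matrix (Fin 3) (Fin 3) ℝ} {x : N}
    (hf : ∀ i j, ContMDiffAt J 𝓘(ℝ, ℝ) n (fun y => f y i j) x) (hx : 1 + (f x).trace ≠ 0) :
    ContMDiffAt J 𝓘(ℝ, E3) n (fun y => gibbs (f y)) x := by
  have ht : ContMDiffAt J 𝓘(ℝ, ℝ) n (fun y => 1 + (f y).trace) x := by
    simp only [Matrix.trace, Fin.sum_univ_three, Matrix.diag_apply]
    exact contMDiffAt_const.add (((hf 0 0).add (hf 1 1)).add (hf 2 2))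
  have hc : ContMDiffAt J 𝓘(ℝ, Fin 3 → ℝ) n (fun y => WithLp.ofLp (gibbs (f y))) x := by
    rw [contMDiffAt_pi_space]
    intro i
    fin_cases i
    · exact ((hf 2 1).sub (hf 1 2)).div₀ ht hx
    · exact ((hf 0 2).sub (hf 2 0)).div₀ ht hx
    · exact ((hf 1 0).sub (hf 0 1)).div₀ ht hx
  exact (EuclideanSpace.equiv (Fin 3) ℝ).symm.contDiff.contMDiff.contMDiffAt.comp x hc

theorem continuousOn_gibbs : ContinuousOn gibbs {M | 1 + M.trace ≠ 0} := by
  have ht : Continuous fun M : Matrix (Fin 3) (Fin 3) ℝ => 1 + M.trace :=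
    continuous_const.add continuous_id.matrix_trace
  refine (PiLp.continuous_toLp 2 _).comp_continuousOn (continuousOn_pi.2 fun i => ?_)
  fin_cases i <;>
    exact ContinuousOn.div (by fun_prop) ht.continuousOn fun _ h => h

/-- The Cayley chart of `SO(3)` centred at `B`: it sends `A` to the Gibbs vector of `B⁻¹ A`. -/
def cayleyChart (B : SO3) : OpenPartialHomeomorph SO3 E3 where
  toFun A := gibbs (B⁻¹ * A : SO3)
  invFun s := B * rot s
  source := {A | 1 + ((B⁻¹ * A : SO3) : Matrix (Fin 3) (Fin 3) ℝ).trace ≠ 0}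
  target := Set.univ
  map_source' _ _ := Set.mem_univ _
  map_target' s _ := by
    have h := (den_pos s).ne'
    simp only [Set.mem_ofPred_eq, inv_mul_cancel_left]
    change 1 + (rotMatrix s).trace ≠ 0
    rw [trace_rot]
    positivity
  left_inv' A hA := by
    have : rot (gibbs (B⁻¹ * A : SO3)) = B⁻¹ * A := Subtype.ext (rot_gibbs (B⁻¹ * A).2 hA)
    rw [this, mul_inv_cancel_left]
  right_inv' s _ := by
    rw [inv_mul_cancel_left]
    exact gibbs_rot s
  open_source := by
    refine isOpen_ne.preimage (continuous_const.add ?_)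
    exact (continuous_coe.comp (continuous_const.mul continuous_id)).matrix_trace
  open_target := isOpen_univ
  continuousOn_toFun :=
    (continuousOn_gibbs).comp
      (continuous_coe.comp (continuous_const.mul continuous_id)).continuousOn fun _ h => h
  continuousOn_invFun := (continuous_const.mul continuous_rot).continuousOn

/-- The smooth atlas of `SO(3)` formed by all Cayley charts. -/
instance : ChartedSpace E3 SO3 where
  atlas := Set.range cayleyChart
  chartAt := cayleyChart
  mem_chart_source A := by
    change 1 + ((A⁻¹ * A : SO3) : Matrix (Fin 3) (Fin 3) ℝ).trace ≠ 0
    rw [inv_mul_cancel]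
    change 1 + (1 : Matrix (Fin 3) (Fin 3) ℝ).trace ≠ 0
    rw [Matrix.trace_one]
    norm_num
  chart_mem_atlas A := ⟨A, rfl⟩

theorem contMDiff_mul_rot {n : WithTop ℕ∞} (C : SO3) (i j : Fin 3) :
    ContMDiff 𝓘(ℝ, E3) 𝓘(ℝ, ℝ) n
      (fun s : E3 => ((C * rot s : SO3) : Matrix (Fin 3) (Fin 3) ℝ) i j) := by
  have : (fun s : E3 => ((C * rot s : SO3) : Matrix (Fin 3) (Fin 3) ℝ) i j) =
      fun s => ∑ k, (C : Matrix (Fin 3) (Fin 3) ℝ) i k * rotMatrix s k j := by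
    ext s
    exact Matrix.mul_apply
  rw [this, contMDiff_iff_contDiff]
  exact ContDiff.sum fun k _ => contDiff_const.mul (contDiff_rotMatrix k j)

instance instIsManifold {n : WithTop ℕ∞} : IsManifold 𝓘(ℝ, E3) n SO3 := by
  refine isManifold_of_contDiffOn _ _ _ ?_
  rintro _ _ ⟨A, rfl⟩ ⟨B, rfl⟩
  intro s hs
  refine ContDiffAt.contDiffWithinAt ?_
  have hs' : 1 + ((B⁻¹ * (A * rot s) : SO3) : Matrix (Fin 3) (Fin 3) ℝ).trace ≠ 0 := hs.1.2
  rw [← contMDiffAt_iff_contDiffAt]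
  refine contMDiffAt_gibbs (J := 𝓘(ℝ, E3)) (f := fun s => ((B⁻¹ * (A * rot s) : SO3) : Matrix _ _ ℝ))
    (fun i j => ?_) hs'
  simp only [← mul_assoc]
  exact (contMDiff_mul_rot (B⁻¹ * A) i j).contMDiffAt

/-- The matrix entries are smooth functions on `SO(3)`. -/
theorem contMDiff_entry {n : WithTop ℕ∞} (i j : Fin 3) :
    ContMDiff 𝓘(ℝ, E3) 𝓘(ℝ, ℝ) n (fun A : SO3 => (A : Matrix (Fin 3) (Fin 3) ℝ) i j) := by
  intro A
  have h1 : ContMDiffAt 𝓘(ℝ, E3) 𝓘(ℝ, E3) n (chartAt E3 A : SO3 → E3) A :=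
    contMDiffAt_of_mem_maximalAtlas (I := 𝓘(ℝ, E3)) (IsManifold.chart_mem_maximalAtlas A)
      (mem_chart_source E3 A)
  have h2 := ((contMDiff_mul_rot (n := n) A i j).contMDiffAt
    (x := (chartAt E3 A : SO3 → E3) A)).comp A h1
  refine h2.congr_of_eventuallyEq ?_
  filter_upwards [(chartAt E3 A).open_source.mem_nhds (mem_chart_source E3 A)] with B hB
  have := (chartAt E3 A).left_inv hB
  exact (congrArg (fun C : SO3 => (C : Matrix (Fin 3) (Fin 3) ℝ) i j) this).symm

/-- A map into `SO(3)` with smooth matrix entries is smooth. -/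
theorem contMDiff_of_entries {n : WithTop ℕ∞} {F : Type*} [NormedAddCommGroup F]
    [NormedSpace ℝ F] {H : Type*} [TopologicalSpace H] {J : ModelWithCorners ℝ F H}
    {N : Type*} [TopologicalSpace N] [ChartedSpace H N] {f : N → SO3}
    (hf : ∀ i j, ContMDiff J 𝓘(ℝ, ℝ) n (fun y => (f y : Matrix (Fin 3) (Fin 3) ℝ) i j)) :
    ContMDiff J 𝓘(ℝ, E3) n f := by
  intro x
  have hc : Continuous f :=
    Continuous.subtype_mk (continuous_matrix fun i j => (hf i j).continuous) _
  rw [contMDiffAt_iff_target]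
  refine ⟨hc.continuousAt, ?_⟩
  have hx : 1 + (((f x)⁻¹ * f x : SO3) : Matrix (Fin 3) (Fin 3) ℝ).trace ≠ 0 :=
    mem_chart_source E3 (f x)
  refine contMDiffAt_gibbs (J := J) (f := fun y => (((f x)⁻¹ * f y : SO3) : Matrix _ _ ℝ))
    (fun i j => ?_) hx
  have : (fun y => (((f x)⁻¹ * f y : SO3) : Matrix (Fin 3) (Fin 3) ℝ) i j) =
      fun y => ∑ k, (((f x)⁻¹ : SO3) : Matrix (Fin 3) (Fin 3) ℝ) i k *
        (f y : Matrix (Fin 3) (Fin 3) ℝ) k j := by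
    ext y
    exact Matrix.mul_apply
  rw [this]
  exact ContMDiffAt.sum fun k _ => contMDiffAt_const.mul (hf k j x)

/-- `SO(3)` is a Lie group. -/
instance instLieGroup {n : WithTop ℕ∞} : LieGroup 𝓘(ℝ, E3) n SO3 where
  contMDiff_mul := by
    refine contMDiff_of_entries fun i j => ?_
    have : (fun p : SO3 × SO3 => ((p.1 * p.2 : SO3) : Matrix (Fin 3) (Fin 3) ℝ) i j) =
        fun p => ∑ k, (p.1 : Matrix (Fin 3) (Fin 3) ℝ) i k *
          (p.2 : Matrix (Fin 3) (Fin 3) ℝ) k j := by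
      ext p
      exact Matrix.mul_apply
    rw [this]
    exact ContMDiff.sum fun k _ =>
      ((contMDiff_entry i k).comp contMDiff_fst).mul ((contMDiff_entry k j).comp contMDiff_snd)
  contMDiff_inv := contMDiff_of_entries fun i j => contMDiff_entry j i


/-- The Lie algebra of `SO(3)`, that is, the tangent space at the identity with the bracket of
left-invariant vector fields. -/
abbrev LieAlg : Type := GroupLieAlgebra 𝓘(ℝ, E3) SO3

/-- `(0,2)`-tensor fields on `SO(3)`. No smoothness is imposed: all tensor fields below are
left-invariant, hence smooth. -/
abbrev TensorField : Type :=
  ∀ x : SO3, TangentSpace 𝓘(ℝ, E3) x →ₗ[ℝ] TangentSpace 𝓘(ℝ, E3) x →ₗ[ℝ] ℝ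

/-- Vector fields on `SO(3)`. -/
abbrev VecField : Type := ∀ x : SO3, TangentSpace 𝓘(ℝ, E3) x

/-- Invariance of a `(0,2)`-tensor field under all left translations. -/
def IsLeftInvariant (T : TensorField) : Prop :=
  ∀ (a x : SO3) (v w : TangentSpace 𝓘(ℝ, E3) x),
    T (a * x) (mfderiv 𝓘(ℝ, E3) 𝓘(ℝ, E3) (fun y : SO3 => a * y) x v)
      (mfderiv 𝓘(ℝ, E3) 𝓘(ℝ, E3) (fun y : SO3 => a * y) x w) = T x v w

/-- A left-invariant Riemannian metric: a left-invariant `(0,2)`-tensor field that is symmetric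
and positive definite at each point. -/
structure IsLeftInvariantMetric (g : TensorField) : Prop where
  leftInvariant : IsLeftInvariant g
  symm : ∀ x v w, g x v w = g x w v
  pos : ∀ x v, v ≠ 0 → 0 < g x v v

/-- Differentiability of a vector field at a point, as a section of the tangent bundle. -/
def IsDiffAt (X : VecField) (x : SO3) : Prop :=
  MDifferentiableAt 𝓘(ℝ, E3) (𝓘(ℝ, E3).prod 𝓘(ℝ, E3))
    (fun y => (⟨y, X y⟩ : TangentBundle 𝓘(ℝ, E3) SO3)) x

/-- Affine connections on `SO(3)`; `cov Y x v` is the derivative `∇_v Y` at `x`. -/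
abbrev Connection : Type :=
  CovariantDerivative 𝓘(ℝ, E3) E3 (TangentSpace 𝓘(ℝ, E3) : SO3 → Type)

/-- `cov` is the Levi-Civita connection of `g`: it is torsion-free and
`v (g(X, Y)) = g(∇_v X, Y) + g(X, ∇_v Y)`. -/
structure IsLeviCivita (g : TensorField) (cov : Connection) : Prop where
  torsion_free : cov.torsion = 0
  metric : ∀ (X Y : VecField) (x : SO3), IsDiffAt X x → IsDiffAt Y x →
    ∀ v : TangentSpace 𝓘(ℝ, E3) x,
      mvfderiv 𝓘(ℝ, E3) (fun y => g y (X y) (Y y)) x v =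
        g x (cov X x v) (Y x) + g x (X x) (cov Y x v)

/-- The curvature `R(X, Y)Z = ∇_X ∇_Y Z - ∇_Y ∇_X Z - ∇_[X, Y] Z`. -/
def curvature (cov : Connection) (X Y Z : VecField) : VecField := fun x =>
  cov (fun y => cov Z y (Y y)) x (X x) - cov (fun y => cov Z y (X y)) x (Y x) -
    cov Z x (VectorField.mlieBracket 𝓘(ℝ, E3) X Y x)

/-- The left-invariant vector field whose value at `x` is `v`. -/
def leftInvariantExtension (x : SO3) (v : TangentSpace 𝓘(ℝ, E3) x) : VecField := fun y =>
  (mfderiv 𝓘(ℝ, E3) 𝓘(ℝ, E3) (fun z : SO3 => y * x⁻¹ * z) x v : E3)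

instance instFiniteDimensionalTangentSpace (x : SO3) :
    FiniteDimensional ℝ (TangentSpace 𝓘(ℝ, E3) x) :=
  inferInstanceAs (FiniteDimensional ℝ E3)

/-- The Ricci curvature `Ric(v, w)` at `x`: the trace of `u ↦ R(u, v)w`, an endomorphism of the
tangent space at `x`. As the curvature is a tensor, it may be computed on any extensions of
`u`, `v`, `w` to vector fields; the left-invariant ones are used. -/
def ricci (cov : Connection) (x : SO3) (v w : TangentSpace 𝓘(ℝ, E3) x) : ℝ :=
  ∑ i, (Module.finBasis ℝ (TangentSpace 𝓘(ℝ, E3) x)).coord i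
    (curvature cov
      (leftInvariantExtension x (Module.finBasis ℝ (TangentSpace 𝓘(ℝ, E3) x) i))
      (leftInvariantExtension x v) (leftInvariantExtension x w) x)

/-- `(g, c)` is a solution of the prescribed Ricci curvature problem `Ric(g) = c T`, where `g` is a
left-invariant Riemannian metric and `c > 0`. -/
structure IsSolution (T g : TensorField) (c : ℝ) : Prop where
  metric : IsLeftInvariantMetric g
  pos : 0 < c
  ricci_eq : ∃ cov : Connection, IsLeviCivita g cov ∧
    ∀ (x : SO3) (v w : TangentSpace 𝓘(ℝ, E3) x), ricci cov x v w = c * T x v w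

/-- `g'` is a positive multiple of `g`. -/
def Homothetic (g g' : TensorField) : Prop := ∃ k : ℝ, 0 < k ∧ g' = k • g

/-- The problem `Ric(g) = c T` has exactly one solution up to scaling of `g`. -/
def HasUniqueSolution (T : TensorField) : Prop :=
  ∃ g c, IsSolution T g c ∧ ∀ g' c', IsSolution T g' c' → Homothetic g g' ∧ c' = c

/-- The problem `Ric(g) = c T` has exactly two solutions up to scaling of `g`, and their constants
`c` are different. -/
def HasExactlyTwoSolutions (T : TensorField) : Prop :=
  ∃ g₁ c₁ g₂ c₂, IsSolution T g₁ c₁ ∧ IsSolution T g₂ c₂ ∧ c₁ ≠ c₂ ∧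
    ∀ g c, IsSolution T g c → (Homothetic g₁ g ∧ c = c₁) ∨ (Homothetic g₂ g ∧ c = c₂)

/-- The problem `Ric(g) = c T` has infinitely many solutions no two of which agree up to scaling of
`g`, and `c = c₀` for every solution. -/
def HasInfinitelyManySolutionsWith (T : TensorField) (c₀ : ℝ) : Prop :=
  (∃ G : ℕ → TensorField, (∀ n, IsSolution T (G n) c₀) ∧
    ∀ m n, m ≠ n → ¬ Homothetic (G m) (G n)) ∧
  ∀ g c, IsSolution T g c → c = c₀

/-- The Levi-Civita symbol. -/
def levi (i j k : Fin 3) : ℝ :=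
  (((j : ℕ) : ℝ) - ((i : ℕ) : ℝ)) * (((k : ℕ) : ℝ) - ((i : ℕ) : ℝ)) *
    (((k : ℕ) : ℝ) - ((j : ℕ) : ℝ)) / 2

/-- The bracket relations `[V_i, V_j] = ∑_k ε_{ijk} λ_k V_k`. -/
def IsMilnorBasis (lam : Fin 3 → ℝ) (V : Module.Basis (Fin 3) ℝ LieAlg) : Prop :=
  ∀ i j, ⁅V i, V j⁆ = ∑ k, (levi i j k * lam k) • V k

/-- `T = diag(t 0, t 1, t 2)` in the basis `V` of the Lie algebra. -/
def IsDiagonalIn (T : TensorField) (V : Module.Basis (Fin 3) ℝ LieAlg) (t : Fin 3 → ℝ) : Prop :=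
  ∀ i j, T 1 (V i) (V j) = if i = j then t i else 0

/-- The cubic polynomial `2p³ + (T₁ + T₂ + T₃)p² - T₁T₂T₃`. -/
def fbar (T₁ T₂ T₃ p : ℝ) : ℝ := 2 * p ^ 3 + (T₁ + T₂ + T₃) * p ^ 2 - T₁ * T₂ * T₃

/-- The first sign condition: `T₁ ≥ T₂ ≥ T₃ > 0`. -/
def CaseI (T₁ T₂ T₃ : ℝ) : Prop := T₁ ≥ T₂ ∧ T₂ ≥ T₃ ∧ T₃ > 0

/-- The second sign condition: `T₁ > 0` and `T₂ = T₃ = 0`. -/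
def CaseII (T₁ T₂ T₃ : ℝ) : Prop := T₁ > 0 ∧ T₂ = 0 ∧ T₃ = 0

/-- The third condition: `T₁ > 0 > T₂ ≥ T₃` and sign conditions on the cubic `fbar`. -/
def CaseIII (T₁ T₂ T₃ : ℝ) : Prop :=
  T₁ > 0 ∧ T₃ ≤ T₂ ∧ T₂ < 0 ∧
    ((fbar T₁ T₂ T₃ (-(T₁ + T₂ + T₃) / 3) ≥ 0 ∧ -(T₁ + T₂ + T₃) / 3 < 0) ∨
      fbar T₁ T₂ T₃ (-T₁) > 0)

/-- The exceptional part of the third case. -/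
def Exceptional (T₁ T₂ T₃ : ℝ) : Prop :=
  fbar T₁ T₂ T₃ (-T₁) < 0 ∧ -(T₁ + T₂ + T₃) / 3 < 0 ∧
    fbar T₁ T₂ T₃ (-(T₁ + T₂ + T₃) / 3) > 0

end SO3

end

noncomputable section

namespace SO3

open Bundle VectorField

/-! Left translations turn the problem into algebra on the Lie algebra. On left-invariant fields the
Levi-Civita connection is the unique bilinear map that is torsion-free and skew for the inner
product (`IsAlgLeviCivita.unique`), and Ricci curvature is the trace of an explicit endomorphism
(`ricci_leftEquiv`). In Gibbs coordinates the bracket is twice the cross product (`lie_eq`), so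
Milnor bases exist and any two of them differ by a rotation. By the spectral theorem every
left-invariant metric is diag(x₀, x₁, x₂) in some Milnor basis. Its Ricci tensor is then diagonal
too, with entries 2μⱼμₖ/(xⱼxₖ), where μᵢ = x₀ + x₁ + x₂ - 2xᵢ; hence so is T.

Put p = μ₀μ₁μ₂/(c x₀x₁x₂). If the diagonal entries of T are sᵢ, then p = μᵢsᵢ/(2xᵢ), hence 2xᵢ(sᵢ +
p) = (x₀ + x₁ + x₂)sᵢ. So up to scale xᵢ = sᵢ/(sᵢ + p), and the normalization ∑ sᵢ/(sᵢ + p) = 2 is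
the equation fbar(p) = 0 after clearing denominators. Moreover c s₀s₁s₂ = 8p². For s₀s₁s₂ > 0,
solutions up to scaling thus correspond to the roots p that make all xᵢ positive
(`isSolution_of_root`, `IsSolution.exists_root`).

Since μᵢ + μⱼ = 2xₖ > 0, at most one μᵢ is not positive, which leaves three signatures
(`ricci_signature`). All μᵢ > 0 gives p > 0 and T positive, and the cubic has a single positive
root. One μᵢ = 0 gives p = 0 and T = diag(8/c, 0, 0) up to order, with a whole family of metrics.
One μᵢ < 0 gives p < 0 and signature (+, -, -); the admissible roots lie in (-T₁, 0). There fbar is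
negative at both ends and its local maximum is at -(T₁ + T₂ + T₃)/3, so the value there decides
between zero, one and two roots. -/

/-! ### Left trivialization of the tangent bundle. -/

theorem mdifferentiableAt_mul_left (a x : SO3) :
    MDifferentiableAt 𝓘(ℝ, E3) 𝓘(ℝ, E3) (fun y : SO3 => a * y) x :=
  (contMDiff_mul_left (I := 𝓘(ℝ, E3)) (n := 1)).mdifferentiableAt one_ne_zero

/-- Chain rule for left translations. -/
theorem mfderiv_mul_left_comp (a b x : SO3) (v : TangentSpace 𝓘(ℝ, E3) x) :
    (mfderiv 𝓘(ℝ, E3) 𝓘(ℝ, E3) (fun y : SO3 => a * y) (b * x)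
      (mfderiv 𝓘(ℝ, E3) 𝓘(ℝ, E3) (fun y : SO3 => b * y) x v) : E3) =
    mfderiv 𝓘(ℝ, E3) 𝓘(ℝ, E3) (fun y : SO3 => a * b * y) x v := by
  have h : (fun y : SO3 => a * b * y) = (fun y => a * y) ∘ fun y => b * y := by
    ext1 y; exact mul_assoc a b y
  rw [h, mfderiv_comp (I' := 𝓘(ℝ, E3)) x (mdifferentiableAt_mul_left a _)
    (mdifferentiableAt_mul_left b x)]
  rfl

theorem mfderiv_one_mul (x : SO3) (v : TangentSpace 𝓘(ℝ, E3) x) :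
    (mfderiv 𝓘(ℝ, E3) 𝓘(ℝ, E3) (fun y : SO3 => 1 * y) x v : E3) = v := by
  have h : (fun y : SO3 => 1 * y) = id := by ext1 y; exact one_mul y
  rw [h, mfderiv_id]
  rfl

theorem mfderiv_mul_left_congr (a : SO3) {x y : SO3} (h : x = y) (v : E3) :
    (mfderiv 𝓘(ℝ, E3) 𝓘(ℝ, E3) (fun z : SO3 => a * z) x v : E3) =
      mfderiv 𝓘(ℝ, E3) 𝓘(ℝ, E3) (fun z : SO3 => a * z) y v := by
  subst h; rfl

/-- The differential of left translation by `x`, from the Lie algebra to the tangent space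
at `x`. -/
def leftEquiv (x : SO3) : LieAlg ≃ₗ[ℝ] TangentSpace 𝓘(ℝ, E3) x where
  toFun v := mulInvariantVectorField v x
  map_add' v w := by rw [mulInvariantVectorField_add]; rfl
  map_smul' c v := by rw [mulInvariantVectorField_smul]; rfl
  invFun v := (mfderiv 𝓘(ℝ, E3) 𝓘(ℝ, E3) (fun y : SO3 => x⁻¹ * y) x v : E3)
  left_inv v := by
    have h := mfderiv_mul_left_comp x⁻¹ x 1 v
    rw [inv_mul_cancel] at h
    rw [mfderiv_one_mul] at h
    exact Eq.trans (mfderiv_mul_left_congr _ (mul_one x).symm _) h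
  right_inv v := by
    have h := mfderiv_mul_left_comp x x⁻¹ x v
    rw [mul_inv_cancel] at h
    rw [mfderiv_one_mul] at h
    exact Eq.trans (mfderiv_mul_left_congr _ (inv_mul_cancel x).symm _) h

theorem leftEquiv_one (v : LieAlg) : leftEquiv 1 v = v := mfderiv_one_mul 1 v

theorem mfderiv_leftEquiv (a x : SO3) (v : LieAlg) :
    mfderiv 𝓘(ℝ, E3) 𝓘(ℝ, E3) (fun y : SO3 => a * y) x (leftEquiv x v) = leftEquiv (a * x) v := by
  have h := mfderiv_mul_left_comp a x 1 v
  exact Eq.trans (mfderiv_mul_left_congr _ (mul_one x).symm _) h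

theorem leftInvariantExtension_leftEquiv (x : SO3) (v : LieAlg) :
    leftInvariantExtension x (leftEquiv x v) = mulInvariantVectorField v := by
  funext y
  unfold leftInvariantExtension
  rw [mfderiv_leftEquiv, inv_mul_cancel_right]
  rfl

theorem isLeftInvariant_iff (T : TensorField) :
    IsLeftInvariant T ↔ ∀ x v w, T x (leftEquiv x v) (leftEquiv x w) = T 1 v w := by
  constructor
  · intro h x v w
    have := h x 1 (leftEquiv 1 v) (leftEquiv 1 w)
    rw [mfderiv_leftEquiv, mfderiv_leftEquiv, mul_one, leftEquiv_one, leftEquiv_one] at this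
    exact this
  · intro h a x v w
    obtain ⟨v, rfl⟩ := (leftEquiv x).surjective v
    obtain ⟨w, rfl⟩ := (leftEquiv x).surjective w
    rw [mfderiv_leftEquiv, mfderiv_leftEquiv, h, h]

theorem isDiffAt_mulInvariantVectorField (v : LieAlg) (x : SO3) :
    IsDiffAt (mulInvariantVectorField v) x :=
  mdifferentiableAt_mulInvariantVectorField (I := 𝓘(ℝ, E3)) (G := SO3) v

theorem mlieBracket_mulInvariantVectorField (v w : LieAlg) :
    mlieBracket 𝓘(ℝ, E3) (mulInvariantVectorField v) (mulInvariantVectorField w) =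
      mulInvariantVectorField (I := 𝓘(ℝ, E3)) (G := SO3) ⁅v, w⁆ :=
  (mulInvariantVector_mlieBracket v w).symm

/-- The vector field `Y` in the left-invariant trivialization of the tangent bundle. -/
def leftCoord (Y : VecField) (x : SO3) : E3 := (leftEquiv x).symm (Y x)

/-- The tangent map of multiplication at (y⁻¹, y), applied to (0, Y y), is the translate of Y y to
the identity. This writes the left-invariant coordinates of Y as a composite of differentiable maps.
-/
theorem mdifferentiableAt_leftCoord {Y : VecField} {x : SO3} (hY : IsDiffAt Y x) :
    MDifferentiableAt 𝓘(ℝ, E3) 𝓘(ℝ, E3) (leftCoord Y) x := by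
  let F : SO3 → TangentBundle (𝓘(ℝ, E3).prod 𝓘(ℝ, E3)) (SO3 × SO3) := fun y =>
    (equivTangentBundleProd 𝓘(ℝ, E3) SO3 𝓘(ℝ, E3) SO3).symm
      ((⟨y⁻¹, 0⟩ : TangentBundle 𝓘(ℝ, E3) SO3), (⟨y, Y y⟩ : TangentBundle 𝓘(ℝ, E3) SO3))
  have h0 : MDifferentiable 𝓘(ℝ, E3) (𝓘(ℝ, E3).prod 𝓘(ℝ, E3))
      (fun y : SO3 => (⟨y⁻¹, 0⟩ : TangentBundle 𝓘(ℝ, E3) SO3)) := by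
    have h1 : ContMDiff 𝓘(ℝ, E3) (𝓘(ℝ, E3).prod 𝓘(ℝ, E3)) 1
      (fun y : SO3 => (⟨y, 0⟩ : TangentBundle 𝓘(ℝ, E3) SO3)) := contMDiff_zeroSection _ _
    exact (h1.comp (contMDiff_inv 𝓘(ℝ, E3) 1)).mdifferentiable one_ne_zero
  have hF : MDifferentiableAt 𝓘(ℝ, E3) (𝓘(ℝ, E3).prod 𝓘(ℝ, E3)).tangent
      F x := by
    refine MDifferentiableAt.comp x ?_ ((h0 x).prodMk hY)
    exact (contMDiff_equivTangentBundleProd_symm (n := 1)).mdifferentiableAt one_ne_zero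
  have hm : MDifferentiable (𝓘(ℝ, E3).prod 𝓘(ℝ, E3)).tangent
      (𝓘(ℝ, E3).prod 𝓘(ℝ, E3))
      (tangentMap (𝓘(ℝ, E3).prod 𝓘(ℝ, E3)) 𝓘(ℝ, E3) fun p : SO3 × SO3 => p.1 * p.2) :=
    (ContMDiff.contMDiff_tangentMap (m := 1) (n := 2) (contMDiff_mul 𝓘(ℝ, E3) 2)
      (by norm_num)).mdifferentiable one_ne_zero
  have h := (hm (F x)).comp x hF
  have e : ((tangentMap (𝓘(ℝ, E3).prod 𝓘(ℝ, E3)) 𝓘(ℝ, E3) fun p : SO3 × SO3 => p.1 * p.2) ∘ F) =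
      fun y => (⟨1, leftCoord Y y⟩ : TangentBundle 𝓘(ℝ, E3) SO3) := by
    funext y
    have hd := mfderiv_prod_eq_add_apply (I := 𝓘(ℝ, E3)) (I' := 𝓘(ℝ, E3)) (I'' := 𝓘(ℝ, E3))
      (f := fun p : SO3 × SO3 => p.1 * p.2) (p := (y⁻¹, y)) (v := (0, Y y))
      ((contMDiff_mul 𝓘(ℝ, E3) 1).mdifferentiable one_ne_zero _)
    simp only [Function.comp, tangentMap, F]
    refine Bundle.TotalSpace.ext (inv_mul_cancel y) (heq_of_eq ?_)
    refine Eq.trans hd ?_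
    exact (congrArg (fun u : E3 => u + _) (map_zero (mfderiv 𝓘(ℝ, E3) 𝓘(ℝ, E3)
      (fun z : SO3 => z * y) y⁻¹))).trans (zero_add _)
  rw [e] at h
  have h2 := ((mdifferentiableAt_totalSpace _ _).1 h).2
  refine h2.congr_of_eventuallyEq (Filter.Eventually.of_forall fun y => ?_)
  -- The base point is constantly 1, where the preferred trivialization is the identity on the
  -- fibre.
  exact ((tangentBundleCore 𝓘(ℝ, E3) SO3).coordChange_self (achart E3 (1 : SO3)) 1
    (mem_achart_source E3 (1 : SO3)) (leftCoord Y y)).symm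

/-! ### Levi-Civita connection and Ricci curvature of a left-invariant metric. -/

/-- `Γ` is torsion-free and compatible with `B`, as is the Levi-Civita connection of a
left-invariant metric on left-invariant vector fields. -/
structure IsAlgLeviCivita (B : LieAlg →ₗ[ℝ] LieAlg →ₗ[ℝ] ℝ) (Γ : LieAlg → LieAlg → LieAlg) :
    Prop where
  torsion : ∀ v w, Γ v w - Γ w v = ⁅v, w⁆
  metric : ∀ u v w, B (Γ u v) w + B v (Γ u w) = 0

/-- The difference of two such maps gives a trilinear expression symmetric in its first two
arguments and skew in its last two; permuting the arguments around shows that it equals its own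
negative. -/
theorem IsAlgLeviCivita.unique {B : LieAlg →ₗ[ℝ] LieAlg →ₗ[ℝ] ℝ} (symm : ∀ v w, B v w = B w v)
    (pos : ∀ v, v ≠ 0 → 0 < B v v) {Γ Γ' : LieAlg → LieAlg → LieAlg}
    (h : IsAlgLeviCivita B Γ) (h' : IsAlgLeviCivita B Γ') : Γ = Γ' := by
  have s : ∀ u v, Γ u v - Γ' u v = Γ v u - Γ' v u := fun u v => by
    have := (h.torsion u v).trans (h'.torsion u v).symm
    rw [sub_eq_sub_iff_add_eq_add] at this ⊢
    rw [this, add_comm]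
  have a : ∀ u v w, B (Γ u v - Γ' u v) w = - B (Γ u w - Γ' u w) v := fun u v w => by
    have h1 := h.metric u v w
    have h2 := h'.metric u v w
    rw [symm v] at h1 h2
    simp only [map_sub, LinearMap.sub_apply]
    linarith
  have z : ∀ u v w, B (Γ u v - Γ' u v) w = 0 := fun u v w => by
    have h1 := a u v w
    have h2 := a w u v
    have h3 := a v w u
    rw [s w u, s w v] at h2
    rw [s v u] at h3
    linarith
  funext u v
  by_contra hne
  exact (pos _ (sub_ne_zero.2 hne)).ne' (z u v _)

/-- The function g(X, Y) is constant for left-invariant X and Y, so at each point the connection,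
carried back to the identity, satisfies the two algebraic axioms and uniqueness applies. -/
theorem leviCivita_apply {g : TensorField} (hg : IsLeftInvariantMetric g) {cov : Connection}
    (hcov : IsLeviCivita g cov) {Γ : LieAlg → LieAlg → LieAlg} (hΓ : IsAlgLeviCivita (g 1) Γ)
    (x : SO3) (v w : LieAlg) :
    cov (mulInvariantVectorField w) x (leftEquiv x v) = leftEquiv x (Γ v w) := by
  have hl := (isLeftInvariant_iff g).1 hg.leftInvariant
  have h : IsAlgLeviCivita (g 1) fun v w =>
      (leftEquiv x).symm (cov (mulInvariantVectorField w) x (leftEquiv x v)) := by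
    constructor
    · intro v w
      have := (cov.torsion_eq_zero_iff.1 hcov.torsion_free)
        (isDiffAt_mulInvariantVectorField v x) (isDiffAt_mulInvariantVectorField w x)
      rw [mlieBracket_mulInvariantVectorField] at this
      rw [← map_sub, LinearEquiv.symm_apply_eq]
      exact this
    · intro u v w
      have := hcov.metric _ _ x (isDiffAt_mulInvariantVectorField v x)
        (isDiffAt_mulInvariantVectorField w x) (leftEquiv x u)
      have hc : (fun y : SO3 => g y (mulInvariantVectorField v y) (mulInvariantVectorField w y)) =
          fun _ => g 1 v w := funext fun y => hl y v w
      rw [hc, mvfderiv_const] at this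
      rw [← hl x, ← hl x, LinearEquiv.apply_symm_apply, LinearEquiv.apply_symm_apply]
      exact this.symm
  rw [← LinearEquiv.symm_apply_eq]
  exact congrFun (congrFun (h.unique (hg.symm 1) (hg.pos 1) hΓ) v) w

/-- The endomorphism `u ↦ R(u, v)w` of the Lie algebra, where `R` is the curvature of `Γ`. -/
def ricciEndo (Γ : LieAlg →ₗ[ℝ] LieAlg →ₗ[ℝ] LieAlg) (v w : LieAlg) : LieAlg →ₗ[ℝ] LieAlg :=
  Γ.flip (Γ v w) - Γ v ∘ₗ Γ.flip w + Γ.flip w ∘ₗ (LieAlgebra.ad ℝ LieAlg v : LieAlg →ₗ[ℝ] LieAlg)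

theorem ricciEndo_apply (Γ : LieAlg →ₗ[ℝ] LieAlg →ₗ[ℝ] LieAlg) (u v w : LieAlg) :
    ricciEndo Γ v w u = Γ u (Γ v w) - Γ v (Γ u w) - Γ ⁅u, v⁆ w := by
  rw [← lie_skew u v, map_neg, LinearMap.neg_apply, sub_neg_eq_add]
  rfl

theorem ricci_leftEquiv {g : TensorField} (hg : IsLeftInvariantMetric g) {cov : Connection}
    (hcov : IsLeviCivita g cov) {Γ : LieAlg →ₗ[ℝ] LieAlg →ₗ[ℝ] LieAlg}
    (hΓ : IsAlgLeviCivita (g 1) fun v w => Γ v w) (x : SO3) (v w : LieAlg) :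
    ricci cov x (leftEquiv x v) (leftEquiv x w) = LinearMap.trace ℝ LieAlg (ricciEndo Γ v w) := by
  have key : ∀ u : LieAlg, curvature cov (mulInvariantVectorField u) (mulInvariantVectorField v)
      (mulInvariantVectorField w) x = leftEquiv x (ricciEndo Γ v w u) := fun u => by
    have hc : ∀ a b : LieAlg, (fun y => cov (mulInvariantVectorField b) y
        (mulInvariantVectorField a y)) = mulInvariantVectorField (Γ a b) :=
      fun a b => funext fun y => leviCivita_apply hg hcov hΓ y a b
    rw [curvature, hc, hc, mlieBracket_mulInvariantVectorField]
    refine Eq.trans (congrArg₂ _ (congrArg₂ _ (leviCivita_apply hg hcov hΓ x u _)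
      (leviCivita_apply hg hcov hΓ x v _)) (leviCivita_apply hg hcov hΓ x ⁅u, v⁆ w)) ?_
    rw [ricciEndo_apply, map_sub, map_sub]
  rw [ricci, ← LinearMap.trace_conj' (ricciEndo Γ v w) (leftEquiv x),
    LinearMap.trace_eq_matrix_trace ℝ (Module.finBasis ℝ (TangentSpace 𝓘(ℝ, E3) x)), Matrix.trace]
  refine Finset.sum_congr rfl fun i _ => ?_
  obtain ⟨u, hu⟩ := (leftEquiv x).surjective (Module.finBasis ℝ (TangentSpace 𝓘(ℝ, E3) x) i)
  rw [Matrix.diag_apply, LinearMap.toMatrix_apply, ← hu, leftInvariantExtension_leftEquiv,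
    leftInvariantExtension_leftEquiv, leftInvariantExtension_leftEquiv, key]
  simp [LinearEquiv.conj_apply]

theorem leftCoord_mulInvariantVectorField (v : LieAlg) :
    leftCoord (mulInvariantVectorField v) = fun _ => (v : E3) :=
  funext fun x => (leftEquiv x).symm_apply_apply v

/-- The value of the connection `connectionOf` at a point, in terms of the derivative `d` and the
value `c` of a section in the left-invariant trivialization `Φ`. -/
def connectionMap (Γ : E3 →ₗ[ℝ] E3 →ₗ[ℝ] E3) (Φ : E3 ≃ₗ[ℝ] E3) (d : E3 →L[ℝ] E3) (c : E3) :
    E3 →L[ℝ] E3 :=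
  LinearMap.toContinuousLinearMap (Φ.toLinearMap ∘ₗ
    (d.toLinearMap + Γ.flip c ∘ₗ Φ.symm.toLinearMap))

theorem connectionMap_apply (Γ : E3 →ₗ[ℝ] E3 →ₗ[ℝ] E3) (Φ : E3 ≃ₗ[ℝ] E3) (d : E3 →L[ℝ] E3)
    (c v : E3) : connectionMap Γ Φ d c (Φ v) = Φ (d (Φ v) + Γ v c) := by
  simp [connectionMap]

theorem connectionMap_add (Γ : E3 →ₗ[ℝ] E3 →ₗ[ℝ] E3) (Φ : E3 ≃ₗ[ℝ] E3) (d d' : E3 →L[ℝ] E3)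
    (c c' : E3) : connectionMap Γ Φ (d + d') (c + c') =
      connectionMap Γ Φ d c + connectionMap Γ Φ d' c' := by
  ext1 v
  obtain ⟨v, rfl⟩ := Φ.surjective v
  simp only [add_apply, connectionMap_apply, map_add]
  abel

theorem connectionMap_leibniz (Γ : E3 →ₗ[ℝ] E3 →ₗ[ℝ] E3) (Φ : E3 ≃ₗ[ℝ] E3) (d : E3 →L[ℝ] E3)
    (c : E3) (a : ℝ) (f : E3 →L[ℝ] ℝ) {w : E3} (hw : Φ c = w) :
    connectionMap Γ Φ (a • d + f.smulRight c) (a • c) =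
      a • connectionMap Γ Φ d c + f.smulRight w := by
  subst hw
  ext1 v
  obtain ⟨v, rfl⟩ := Φ.surjective v
  simp only [add_apply, connectionMap_apply, map_add, map_smul,
    smul_apply, ContinuousLinearMap.smulRight_apply, smul_add]
  abel

/-- The connection that is given by `Γ` on left-invariant vector fields. -/
def connectionOf (Γ : LieAlg →ₗ[ℝ] LieAlg →ₗ[ℝ] LieAlg) : Connection where
  toFun Y x := connectionMap Γ (leftEquiv x) (mvfderiv 𝓘(ℝ, E3) (leftCoord Y) x) (leftCoord Y x)
  isCovariantDerivativeOnUniv :=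
    { add := by
        intro Y Z x hY hZ _
        have h : leftCoord (Y + Z) = leftCoord Y + leftCoord Z :=
          funext fun y => map_add (leftEquiv y).symm (Y y) (Z y)
        rw [h, mvfderiv_add (mdifferentiableAt_leftCoord hY) (mdifferentiableAt_leftCoord hZ)]
        exact connectionMap_add Γ (leftEquiv x) _ _ _ _
      leibniz := by
        intro Y f x hY hf _
        have h : leftCoord (f • Y) = f • leftCoord Y :=
          funext fun y => map_smul (leftEquiv y).symm (f y) (Y y)
        rw [h, mvfderiv_smul hf (mdifferentiableAt_leftCoord hY)]
        exact connectionMap_leibniz Γ (leftEquiv x) _ _ _ _ ((leftEquiv x).apply_symm_apply (Y x)) }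

theorem connectionOf_apply (Γ : LieAlg →ₗ[ℝ] LieAlg →ₗ[ℝ] LieAlg) (Y : VecField) (x : SO3)
    (v : LieAlg) : connectionOf Γ Y x (leftEquiv x v) =
      leftEquiv x (id (α := LieAlg) (mvfderiv 𝓘(ℝ, E3) (leftCoord Y) x (leftEquiv x v)) +
        Γ v (leftCoord Y x)) :=
  connectionMap_apply Γ (leftEquiv x) (mvfderiv 𝓘(ℝ, E3) (leftCoord Y) x) (leftCoord Y x) v

theorem mvfderiv_bilin (B : E3 →ₗ[ℝ] E3 →ₗ[ℝ] ℝ) {f h : SO3 → E3} {x : SO3}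
    (hf : MDifferentiableAt 𝓘(ℝ, E3) 𝓘(ℝ, E3) f x) (hh : MDifferentiableAt 𝓘(ℝ, E3) 𝓘(ℝ, E3) h x)
    (v : TangentSpace 𝓘(ℝ, E3) x) :
    mvfderiv 𝓘(ℝ, E3) (fun y => B (f y) (h y)) x v =
      B (mvfderiv 𝓘(ℝ, E3) f x v) (h x) + B (f x) (mvfderiv 𝓘(ℝ, E3) h x v) := by
  let B' : E3 →L[ℝ] E3 →L[ℝ] ℝ :=
    LinearMap.toContinuousLinearMap (LinearMap.toContinuousLinearMap.toLinearMap ∘ₗ B)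
  have hd : HasMFDerivAt 𝓘(ℝ, E3) 𝓘(ℝ, ℝ) (fun y => B (f y) (h y)) x
      (B'.precompR E3 (f x) (mvfderiv 𝓘(ℝ, E3) h x) +
        B'.precompL E3 (mvfderiv 𝓘(ℝ, E3) f x) (h x)) := by
    refine ⟨(B'.isBoundedBilinearMap.continuous.tendsto (f x, h x)).comp
      (hf.continuousAt.prodMk_nhds hh.continuousAt), ?_⟩
    have h0 : (chartAt E3 x).symm (chartAt E3 x x) = x :=
      (chartAt E3 x).left_inv (mem_chart_source E3 x)
    have := B'.hasFDerivWithinAt_of_bilinear hf.hasMFDerivAt.2 hh.hasMFDerivAt.2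
    simp only [writtenInExtChartAt, Function.comp, extChartAt, mfld_simps, h0] at this ⊢
    exact this
  refine Eq.trans (congrArg (fun L => L v) hd.mfderiv) ?_
  exact add_comm _ _

/-- Torsion is a tensor, so it suffices to test it on left-invariant fields, whose coordinates are
constant. Metric compatibility for arbitrary fields is the Leibniz rule for `g 1` in left-invariant
coordinates, because the two terms in Γ cancel. -/
theorem isLeviCivita_connectionOf {g : TensorField} (hg : IsLeftInvariantMetric g)
    {Γ : LieAlg →ₗ[ℝ] LieAlg →ₗ[ℝ] LieAlg} (hΓ : IsAlgLeviCivita (g 1) fun v w => Γ v w) :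
    IsLeviCivita g (connectionOf Γ) := by
  have hl := (isLeftInvariant_iff g).1 hg.leftInvariant
  constructor
  · ext1 x
    refine ContinuousLinearMap.ext fun v => ContinuousLinearMap.ext fun w => ?_
    obtain ⟨v, rfl⟩ := (leftEquiv x).surjective v
    obtain ⟨w, rfl⟩ := (leftEquiv x).surjective w
    have h := (connectionOf Γ).torsion_apply (isDiffAt_mulInvariantVectorField v x)
      (isDiffAt_mulInvariantVectorField w x)
    have hc : ∀ v w : LieAlg, connectionOf Γ (mulInvariantVectorField w) x (leftEquiv x v) =
        leftEquiv x (Γ v w) := fun v w => by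
      have hd : mvfderiv 𝓘(ℝ, E3) (leftCoord (mulInvariantVectorField w)) x = 0 := by
        rw [leftCoord_mulInvariantVectorField]; exact mvfderiv_const (F := E3) w
      rw [connectionOf_apply, hd, leftCoord_mulInvariantVectorField]
      exact congrArg (leftEquiv x) (zero_add (Γ v w))
    refine h.trans ?_
    rw [mlieBracket_mulInvariantVectorField]
    refine Eq.trans (congrArg₂ _ (congrArg₂ _ (hc v w) (hc w v)) rfl) ?_
    rw [← map_sub, hΓ.torsion]
    exact sub_self _
  · intro X Y x hX hY v
    obtain ⟨v, rfl⟩ := (leftEquiv x).surjective v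
    have hc : (fun y : SO3 => g y (X y) (Y y)) =
        fun y => g 1 (leftCoord X y) (leftCoord Y y) := funext fun y => by
      refine Eq.trans ?_ (hl y (leftCoord X y) (leftCoord Y y))
      rw [leftCoord, leftCoord, LinearEquiv.apply_symm_apply, LinearEquiv.apply_symm_apply]
    have aux : ∀ a b c d : LieAlg, g 1 a d + g 1 c b = g x (leftEquiv x (a + Γ v c))
        (leftEquiv x d) + g x (leftEquiv x c) (leftEquiv x (b + Γ v d)) := fun a b c d => by
      rw [hl, hl, map_add, map_add, LinearMap.add_apply]
      linarith [hΓ.metric v c d]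
    have e1 : X x = leftEquiv x (leftCoord X x) := ((leftEquiv x).apply_symm_apply _).symm
    have e2 : Y x = leftEquiv x (leftCoord Y x) := ((leftEquiv x).apply_symm_apply _).symm
    rw [hc, connectionOf_apply, connectionOf_apply, e1, e2]
    exact (mvfderiv_bilin (g 1) (mdifferentiableAt_leftCoord hX)
      (mdifferentiableAt_leftCoord hY) _).trans (aux _ _ _ _)

/-! ### The bracket of the Lie algebra, computed in Gibbs coordinates. -/

/-- The cross product with `s`. -/
def crossL (s : E3) : E3 →L[ℝ] E3 := LinearMap.toContinuousLinearMap
  { toFun t := !₂[s 1 * t 2 - s 2 * t 1, s 2 * t 0 - s 0 * t 2, s 0 * t 1 - s 1 * t 0]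
    map_add' t u := by ext i; fin_cases i <;> simp <;> ring
    map_smul' c t := by ext i; fin_cases i <;> simp <;> ring }

theorem crossL_apply (s t : E3) : crossL s t =
    !₂[s 1 * t 2 - s 2 * t 1, s 2 * t 0 - s 0 * t 2, s 0 * t 1 - s 1 * t 0] := rfl

/-- The scalar product with `s`. -/
def dotL (s : E3) : E3 →L[ℝ] ℝ := LinearMap.toContinuousLinearMap
  { toFun t := s 0 * t 0 + s 1 * t 1 + s 2 * t 2
    map_add' t u := by simp; ring
    map_smul' c t := by simp; ring }

theorem dotL_apply (s t : E3) : dotL s t = s 0 * t 0 + s 1 * t 1 + s 2 * t 2 := rfl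

/-- The Gibbs vector of a product of rotations. -/
def gibbsMul (s t : E3) : E3 := (1 - dotL s t)⁻¹ • (s + t + crossL s t)

/-- Homogeneous form: the right side is the rotation of the quaternion c + u, of which c⁻¹u is the
Gibbs vector. -/
theorem rotMatrix_smul (u : E3) {c : ℝ} (hc : c ≠ 0) : rotMatrix (c⁻¹ • u) =
    (c ^ 2 + (u 0 ^ 2 + u 1 ^ 2 + u 2 ^ 2))⁻¹ •
    !![c ^ 2 + u 0 ^ 2 - u 1 ^ 2 - u 2 ^ 2, 2 * (u 0 * u 1 - c * u 2), 2 * (u 0 * u 2 + c * u 1);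
       2 * (u 0 * u 1 + c * u 2), c ^ 2 - u 0 ^ 2 + u 1 ^ 2 - u 2 ^ 2, 2 * (u 1 * u 2 - c * u 0);
       2 * (u 0 * u 2 - c * u 1), 2 * (u 1 * u 2 + c * u 0),
       c ^ 2 - u 0 ^ 2 - u 1 ^ 2 + u 2 ^ 2] := by
  have h : 1 + ((c⁻¹ • u) 0 ^ 2 + (c⁻¹ • u) 1 ^ 2 + (c⁻¹ • u) 2 ^ 2) =
      (c ^ 2 + (u 0 ^ 2 + u 1 ^ 2 + u 2 ^ 2)) * (c ^ 2)⁻¹ := by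
    simp; field_simp
  rw [rotMatrix, h, mul_inv, inv_inv, mul_smul]
  congr 1
  ext i j
  fin_cases i <;> fin_cases j <;> simp <;> field_simp

/-- Quaternion multiplication: (1 + s)(1 + t) has real part 1 - s·t and imaginary part s + t + s×t.
The identity `hK` is multiplicativity of the norm. -/
theorem rotMatrix_mul {s t : E3} (h : 1 - dotL s t ≠ 0) :
    rotMatrix s * rotMatrix t = rotMatrix (gibbsMul s t) := by
  have hK : (1 - dotL s t) ^ 2 + ((s + t + crossL s t) 0 ^ 2 + (s + t + crossL s t) 1 ^ 2 +
      (s + t + crossL s t) 2 ^ 2) = (1 + (s 0 ^ 2 + s 1 ^ 2 + s 2 ^ 2)) *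
        (1 + (t 0 ^ 2 + t 1 ^ 2 + t 2 ^ 2)) := by
    simp [crossL_apply, dotL_apply]; ring
  rw [gibbsMul, rotMatrix_smul _ h, hK, rotMatrix, rotMatrix, Matrix.smul_mul, Matrix.mul_smul,
    smul_smul, mul_inv]
  congr 1
  ext i j
  fin_cases i <;> fin_cases j <;>
    simp [Matrix.mul_apply, Fin.sum_univ_three, crossL_apply, dotL_apply] <;> ring

theorem contMDiff_rot {n : WithTop ℕ∞} : ContMDiff 𝓘(ℝ, E3) 𝓘(ℝ, E3) n rot :=
  contMDiff_of_entries fun i j => (contDiff_rotMatrix i j).contMDiff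

theorem rot_zero : rot 0 = 1 := by
  refine Subtype.ext ?_
  ext i j
  fin_cases i <;> fin_cases j <;> simp [rot, rotMatrix]

theorem chartAt_one_rot (s : E3) : chartAt E3 (1 : SO3) (rot s) = s := by
  change gibbs ((1⁻¹ * rot s : SO3) : Matrix (Fin 3) (Fin 3) ℝ) = s
  rw [inv_one, one_mul]
  exact gibbs_rot s

theorem hasMFDerivAt_rot_zero : HasMFDerivAt 𝓘(ℝ, E3) 𝓘(ℝ, E3) rot 0
    (ContinuousLinearMap.id ℝ E3) := by
  refine ⟨continuous_rot.continuousAt, ?_⟩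
  have : writtenInExtChartAt 𝓘(ℝ, E3) 𝓘(ℝ, E3) 0 rot = id := by
    funext s
    simp only [writtenInExtChartAt, extChartAt, mfld_simps, rot_zero]
    exact chartAt_one_rot s
  rw [this]
  exact hasFDerivWithinAt_id _ _

theorem hasFDerivAt_gibbsMul (s : E3) : HasFDerivAt (gibbsMul s)
    ((ContinuousLinearMap.id ℝ E3 + crossL s) + (dotL s).smulRight s) 0 := by
  have h1 : HasFDerivAt (fun t => 1 - dotL s t) (-dotL s) 0 :=
    (dotL s).hasFDerivAt.const_sub 1
  have h2 : HasFDerivAt (fun t => s + t + crossL s t) (ContinuousLinearMap.id ℝ E3 + crossL s) 0 :=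
    ((hasFDerivAt_id 0).const_add s).add (crossL s).hasFDerivAt
  have h3 := ((hasDerivAt_inv (x := 1 - dotL s 0) (by simp)).comp_hasFDerivAt 0 h1).smul h2
  refine h3.congr_fderiv ?_
  ext v i
  simp

theorem gibbsMul_zero (s : E3) : gibbsMul s 0 = s := by simp [gibbsMul]

/-- The Gibbs vector is a smooth left inverse, so the differential is injective, hence invertible by
dimension. -/
theorem isInvertible_mfderiv_rot (s : E3) :
    (mfderiv 𝓘(ℝ, E3) 𝓘(ℝ, E3) rot s).IsInvertible := by
  have hg : MDifferentiableAt 𝓘(ℝ, E3) 𝓘(ℝ, E3) (fun A : SO3 => gibbs A) (rot s) := by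
    refine (contMDiffAt_gibbs (n := 1) (fun i j => contMDiff_entry i j _) ?_).mdifferentiableAt
      one_ne_zero
    have := trace_rot s
    have h := den_pos s
    change 1 + (rotMatrix s).trace ≠ 0
    rw [this]; positivity
  have hc := mfderiv_comp (I' := 𝓘(ℝ, E3)) s hg
    ((contMDiff_rot (n := 1)).mdifferentiable one_ne_zero s)
  have hid : ((fun A : SO3 => gibbs A) ∘ rot) = id := funext gibbs_rot
  rw [hid, mfderiv_id] at hc
  have hinj : Function.Injective (mfderiv 𝓘(ℝ, E3) 𝓘(ℝ, E3) rot s : E3 → E3) := by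
    intro v w hvw
    have h1 := congrArg (fun L : E3 →L[ℝ] E3 => L v) hc
    have h2 := congrArg (fun L : E3 →L[ℝ] E3 => L w) hc
    exact h1.trans ((congrArg _ hvw).trans h2.symm)
  let L : E3 →L[ℝ] E3 := mfderiv 𝓘(ℝ, E3) 𝓘(ℝ, E3) rot s
  exact ⟨(LinearEquiv.ofInjectiveEndo L.toLinearMap hinj).toContinuousLinearEquiv,
    ContinuousLinearMap.ext fun _ => rfl⟩

/-- A left-invariant vector field in the coordinates given by Gibbs vectors. -/
def gibbsField (v s : E3) : E3 := v + crossL s v + dotL s v • s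

theorem rot_mul_eventuallyEq (s : E3) :
    (fun t => rot s * rot t) =ᶠ[𝓝 0] fun t => rot (gibbsMul s t) := by
  have hc : ContinuousAt (fun t => 1 - dotL s t) 0 := by fun_prop
  filter_upwards [hc.eventually_ne (y := 0) (by simp)] with t ht
  exact Subtype.ext (rotMatrix_mul ht)

theorem hasMFDerivAt_comp_of_eq {f : E3 → E3} {g : E3 → SO3} {s t : E3} (h : f t = s)
    {L D : E3 →L[ℝ] E3} (hg : HasMFDerivAt 𝓘(ℝ, E3) 𝓘(ℝ, E3) g s L) (hf : HasFDerivAt f D t) :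
    HasMFDerivAt 𝓘(ℝ, E3) 𝓘(ℝ, E3) (fun u => g (f u)) t (L.comp D) := by
  subst h
  exact HasMFDerivAt.comp (I' := 𝓘(ℝ, E3)) t hg hf.hasMFDerivAt

theorem hasMFDerivAt_mul_left_comp (A : SO3) {g : E3 → SO3} {t : E3} {B : SO3} (h : g t = B)
    {L D : E3 →L[ℝ] E3} (hL : HasMFDerivAt 𝓘(ℝ, E3) 𝓘(ℝ, E3) (fun y : SO3 => A * y) B L)
    (hg : HasMFDerivAt 𝓘(ℝ, E3) 𝓘(ℝ, E3) g t D) :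
    HasMFDerivAt 𝓘(ℝ, E3) 𝓘(ℝ, E3) (fun u => A * g u) t (L.comp D) := by
  subst h
  exact HasMFDerivAt.comp (I' := 𝓘(ℝ, E3)) t hL hg

theorem hasMFDerivAt_unique_of_eventuallyEq {f g : E3 → SO3} {t : E3} (h : f =ᶠ[𝓝 t] g)
    {L D : E3 →L[ℝ] E3} (hf : HasMFDerivAt 𝓘(ℝ, E3) 𝓘(ℝ, E3) f t L)
    (hg : HasMFDerivAt 𝓘(ℝ, E3) 𝓘(ℝ, E3) g t D) : L = D :=
  hasMFDerivAt_unique hf (hg.congr_of_eventuallyEq h)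

/-- Differentiate rot s · rot t = rot (gibbsMul s t) in t at 0. The derivative of `gibbsMul s` there
sends v to `gibbsField v s`. -/
theorem mfderiv_rot_gibbsField (v s : E3) {L P : E3 →L[ℝ] E3}
    (hL : HasMFDerivAt 𝓘(ℝ, E3) 𝓘(ℝ, E3) rot s L)
    (hP : HasMFDerivAt 𝓘(ℝ, E3) 𝓘(ℝ, E3) (fun y : SO3 => rot s * y) 1 P) :
    L (gibbsField v s) = P v := by
  have h := hasMFDerivAt_unique_of_eventuallyEq (rot_mul_eventuallyEq s)
    (hasMFDerivAt_mul_left_comp (rot s) rot_zero hP hasMFDerivAt_rot_zero)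
    (hasMFDerivAt_comp_of_eq (gibbsMul_zero s) hL (hasFDerivAt_gibbsMul s))
  exact congrArg (fun L : E3 →L[ℝ] E3 => L v) h.symm

theorem mpullback_rot (v : LieAlg) :
    VectorField.mpullback 𝓘(ℝ, E3) 𝓘(ℝ, E3) rot (mulInvariantVectorField v) = gibbsField v := by
  funext s
  exact ((isInvertible_mfderiv_rot s).inverse_apply_eq).2 
    (mfderiv_rot_gibbsField v s
      ((contMDiff_rot (n := 1)).mdifferentiable one_ne_zero _).hasMFDerivAt
      (mdifferentiableAt_mul_left (rot s) 1).hasMFDerivAt).symm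

theorem hasFDerivAt_gibbsField (v : E3) : HasFDerivAt (gibbsField v) (-crossL v) 0 := by
  have h : gibbsField v = fun s => v - crossL v s + dotL v s • s := by
    funext s
    ext i
    fin_cases i <;> simp [gibbsField, crossL_apply, dotL_apply] <;> ring
  rw [h]
  have := ((crossL v).hasFDerivAt.const_sub v).add
    ((dotL v).hasFDerivAt.smul (hasFDerivAt_id (0 : E3)))
  refine this.congr_fderiv ?_
  ext w i
  simp

theorem lieBracket_gibbsField (v w : E3) :
    VectorField.lieBracket ℝ (gibbsField v) (gibbsField w) 0 = (2 : ℝ) • crossL v w := by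
  rw [VectorField.lieBracket, (hasFDerivAt_gibbsField v).fderiv, (hasFDerivAt_gibbsField w).fderiv]
  ext i
  fin_cases i <;> simp [gibbsField, crossL_apply] <;> ring

theorem gibbsField_zero (v : E3) : gibbsField v 0 = v := by
  ext i
  fin_cases i <;> simp [gibbsField, crossL_apply]

theorem mlieBracket_model (V W : ∀ x : E3, TangentSpace 𝓘(ℝ, E3) x) :
    VectorField.mlieBracket 𝓘(ℝ, E3) V W = VectorField.lieBracket ℝ V W := by
  rw [← VectorField.mlieBracketWithin_univ, VectorField.mlieBracketWithin_eq_lieBracketWithin]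
  exact VectorField.lieBracketWithin_univ

/-- Brackets commute with pullback along `rot`, which reduces the claim to the flat bracket of two
polynomial fields at 0. Only their linear parts -v× and -w× matter, and each contributes v×w. -/
theorem lie_eq (v w : LieAlg) : (⁅v, w⁆ : LieAlg) = (2 : ℝ) • crossL v w := by
  have h := VectorField.mpullback_mlieBracket (n := 3) (I := 𝓘(ℝ, E3)) (I' := 𝓘(ℝ, E3)) (f := rot)
    (x₀ := 0) (V := mulInvariantVectorField v) (W := mulInvariantVectorField w)
    (isDiffAt_mulInvariantVectorField v _) (isDiffAt_mulInvariantVectorField w _)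
    (contMDiff_rot 0) (by simp; norm_num)
  rw [mpullback_rot, mpullback_rot] at h
  rw [mlieBracket_mulInvariantVectorField, mpullback_rot] at h
  have h0 : gibbsField (⁅v, w⁆ : LieAlg) 0 = (⁅v, w⁆ : LieAlg) := gibbsField_zero _
  exact (h0.symm.trans (h.trans (congrFun (mlieBracket_model _ _) 0))).trans
    (lieBracket_gibbsField v w)

theorem crossL_single (i j : Fin 3) :
    (2 : ℝ) • crossL (EuclideanSpace.single i 1) (EuclideanSpace.single j 1) =
      ∑ k, (levi i j k * (![2, 2, 2] : Fin 3 → ℝ) k) • (EuclideanSpace.single k 1 : E3) := by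
  rw [Fin.sum_univ_three]
  ext k
  fin_cases i <;> fin_cases j <;> fin_cases k <;> simp [crossL_apply, levi] <;> norm_num

/-- The standard basis is a Milnor basis. -/
theorem exists_isMilnorBasis : ∃ V : Module.Basis (Fin 3) ℝ LieAlg, IsMilnorBasis ![2, 2, 2] V := by
  obtain ⟨V, hV⟩ : ∃ V : Module.Basis (Fin 3) ℝ E3, ∀ i, V i = EuclideanSpace.single i 1 :=
    ⟨(EuclideanSpace.basisFun (Fin 3) ℝ).toBasis, fun i =>
      (congrFun (OrthonormalBasis.coe_toBasis _) i).trans (EuclideanSpace.basisFun_apply _ _ _)⟩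
  refine ⟨V, fun i j => (lie_eq _ _).trans ?_⟩
  have h := crossL_single i j
  simp only [← hV] at h
  exact h

/-! ### Connection and curvature of a diagonal metric in a Milnor basis. -/

/-- `μ i = x₀ + x₁ + x₂ - 2 xᵢ`. -/
def milnorMu (x : Fin 3 → ℝ) (i : Fin 3) : ℝ := x 0 + x 1 + x 2 - 2 * x i

/-- The Ricci curvatures in a Milnor basis of the metric `diag(x₀, x₁, x₂)`. -/
def ricciDiag (x : Fin 3 → ℝ) : Fin 3 → ℝ :=
  ![2 * (milnorMu x 1 * milnorMu x 2) / (x 1 * x 2),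
    2 * (milnorMu x 2 * milnorMu x 0) / (x 2 * x 0),
    2 * (milnorMu x 0 * milnorMu x 1) / (x 0 * x 1)]

/-- The Levi-Civita connection on left-invariant vector fields of the metric that is
`diag(x₀, x₁, x₂)` in the Milnor basis `V`. -/
def gammaOf (V : Module.Basis (Fin 3) ℝ LieAlg) (x : Fin 3 → ℝ) :
    LieAlg →ₗ[ℝ] LieAlg →ₗ[ℝ] LieAlg :=
  V.constr ℝ fun i => V.constr ℝ fun j => ∑ k, (levi i j k * (milnorMu x i / x k)) • V k

theorem gammaOf_basis (V : Module.Basis (Fin 3) ℝ LieAlg) (x : Fin 3 → ℝ) (i j : Fin 3) :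
    gammaOf V x (V i) (V j) = ∑ k, (levi i j k * (milnorMu x i / x k)) • V k := by
  rw [gammaOf, Module.Basis.constr_basis, Module.Basis.constr_basis]

theorem basis_induction (V : Module.Basis (Fin 3) ℝ LieAlg) {P : LieAlg → Prop}
    (basis : ∀ i, P (V i)) (add : ∀ v w, P v → P w → P (v + w))
    (smul : ∀ (c : ℝ) v, P v → P (c • v)) (v : LieAlg) : P v := by
  have hv : v ∈ Submodule.span ℝ (Set.range V) := by rw [V.span_eq]; trivial
  induction hv using Submodule.span_induction with
  | mem w hw => obtain ⟨i, rfl⟩ := hw; exact basis i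
  | zero => simpa using smul 0 (V 0) (basis 0)
  | add v w _ _ hv hw => exact add v w hv hw
  | smul c v _ hv => exact smul c v hv

/-- Torsion-freeness is μᵢ + μⱼ = 2xₖ for distinct indices; compatibility holds because B(Γ(Vᵢ, Vⱼ),
Vₖ) = εᵢⱼₖ μᵢ is skew in j and k. -/
theorem isAlgLeviCivita_gammaOf {V : Module.Basis (Fin 3) ℝ LieAlg}
    (hV : IsMilnorBasis ![2, 2, 2] V) {x : Fin 3 → ℝ} (hx : ∀ i, x i ≠ 0)
    {B : LieAlg →ₗ[ℝ] LieAlg →ₗ[ℝ] ℝ} (hB : ∀ i j, B (V i) (V j) = if i = j then x i else 0) :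
    IsAlgLeviCivita B fun v w => gammaOf V x v w := by
  have hx0 := hx 0
  have hx1 := hx 1
  have hx2 := hx 2
  constructor
  · refine basis_induction V (fun i => basis_induction V (fun j => ?_) ?_ ?_) ?_ ?_
    · rw [hV, gammaOf_basis, gammaOf_basis, ← Finset.sum_sub_distrib]
      refine Finset.sum_congr rfl fun k _ => ?_
      rw [← sub_smul]
      congr 1
      fin_cases i <;> fin_cases j <;> fin_cases k <;> simp [levi, milnorMu] <;> field_simp <;> ring
    · intro v w hv hw
      rw [lie_add, ← hv, ← hw, map_add, map_add, LinearMap.add_apply]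
      abel
    · intro c v hv
      rw [lie_smul, ← hv, map_smul, map_smul, LinearMap.smul_apply, smul_sub]
    · intro v w hv hw u
      rw [add_lie, ← hv, ← hw, map_add, map_add, LinearMap.add_apply]
      abel
    · intro c v hv u
      rw [smul_lie, ← hv, map_smul, map_smul, LinearMap.smul_apply, smul_sub]
  · have h : ∀ i j k, B (gammaOf V x (V i) (V j)) (V k) = levi i j k * milnorMu x i ∧
        B (V k) (gammaOf V x (V i) (V j)) = levi i j k * milnorMu x i := fun i j k => by
      rw [gammaOf_basis]
      simp only [map_sum, map_smul, LinearMap.sum_apply, LinearMap.smul_apply, hB, smul_eq_mul,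
        mul_ite, mul_zero, Finset.sum_ite_eq, Finset.sum_ite_eq', Finset.mem_univ, if_true]
      have := hx k
      constructor <;> field_simp
    refine basis_induction V (fun i => basis_induction V (fun j =>
      basis_induction V (fun k => ?_) ?_ ?_) ?_ ?_) ?_ ?_
    · rw [(h i j k).1, (h i k j).2, levi, levi]; ring
    · intro v w hv hw; simp only [map_add]; linear_combination hv + hw
    · intro c v hv; simp only [map_smul, smul_eq_mul]; linear_combination c * hv
    · intro v w hv hw u; simp only [map_add, LinearMap.add_apply]; linear_combination hv u + hw u
    · intro c v hv u
      simp only [map_smul, LinearMap.smul_apply, smul_eq_mul]; linear_combination c * hv u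
    · intro v w hv hw u u'
      simp only [map_add, LinearMap.add_apply]; linear_combination hv u u' + hw u u'
    · intro c v hv u u'
      simp only [map_smul, LinearMap.smul_apply, smul_eq_mul]; linear_combination c * hv u u'

/-- The vanishing off-diagonal entries are what later forces T to be diagonal wherever the metric
is. -/
theorem trace_ricciEndo_gammaOf {V : Module.Basis (Fin 3) ℝ LieAlg}
    (hV : IsMilnorBasis ![2, 2, 2] V) {x : Fin 3 → ℝ} (hx : ∀ i, x i ≠ 0) (i j : Fin 3) :
    LinearMap.trace ℝ LieAlg (ricciEndo (gammaOf V x) (V i) (V j)) =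
      if i = j then ricciDiag x i else 0 := by
  have hx0 := hx 0
  have hx1 := hx 1
  have hx2 := hx 2
  rw [LinearMap.trace_eq_matrix_trace ℝ V, Matrix.trace]
  simp only [Matrix.diag_apply, LinearMap.toMatrix_apply, Fin.sum_univ_three, ricciEndo_apply, hV _ _,
    gammaOf_basis, map_add, map_sub, map_smul, LinearMap.add_apply, LinearMap.smul_apply,
    Module.Basis.repr_self, Finsupp.add_apply, Finsupp.sub_apply, Finsupp.smul_apply, smul_eq_mul]
  fin_cases i <;> fin_cases j <;> simp [levi, ricciDiag, milnorMu] <;> field_simp <;> ring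

/-! ### Changes of Milnor basis are rotations. -/

theorem lie_milnor {V : Module.Basis (Fin 3) ℝ LieAlg} (hV : IsMilnorBasis ![2, 2, 2] V)
    (a b : Fin 3 → ℝ) : ⁅∑ i, a i • V i, ∑ i, b i • V i⁆ =
      ∑ k, (2 * ![a 1 * b 2 - a 2 * b 1, a 2 * b 0 - a 0 * b 2, a 0 * b 1 - a 1 * b 0] k) • V k := by
  simp only [Fin.sum_univ_three, add_lie, lie_add, smul_lie, lie_smul, hV _ _]
  simp [levi]
  module

/-- The `k`-th coordinate of the cross product of the columns `i` and `j` of `A`. -/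
def colCross (A : Matrix (Fin 3) (Fin 3) ℝ) (i j : Fin 3) : Fin 3 → ℝ :=
  ![A 1 i * A 2 j - A 2 i * A 1 j, A 2 i * A 0 j - A 0 i * A 2 j, A 0 i * A 1 j - A 1 i * A 0 j]

/-- The rows of the adjugate are the cross products of the columns. The condition therefore says
that A preserves the cross product, that is, the Milnor bracket relations. -/
theorem adjugate_eq_transpose_iff (A : Matrix (Fin 3) (Fin 3) ℝ) :
    A.adjugate = A.transpose ↔ ∀ i j k, colCross A i j k = ∑ l, levi i j l * A k l := by
  constructor
  · intro h
    have a := fun i j => congrFun (congrFun h i) j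
    simp [Matrix.adjugate_fin_three, Fin.forall_fin_succ] at a
    obtain ⟨⟨b00, b01, b02⟩, ⟨b10, b11, b12⟩, b20, b21, b22⟩ := a
    intro i j k
    fin_cases i <;> fin_cases j <;> fin_cases k <;>
      simp [colCross, levi, Fin.sum_univ_three] <;> linarith
  · intro h
    have a := h 1 2
    have b := h 2 0
    have c := h 0 1
    simp [Fin.forall_fin_succ, colCross, levi, Fin.sum_univ_three] at a b c
    obtain ⟨a0, a1, a2⟩ := a
    obtain ⟨b0, b1, b2⟩ := b
    obtain ⟨c0, c1, c2⟩ := c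
    ext i j
    fin_cases i <;> fin_cases j <;> simp [Matrix.adjugate_fin_three] <;> linarith

theorem lie_columns {V : Module.Basis (Fin 3) ℝ LieAlg} (hV : IsMilnorBasis ![2, 2, 2] V)
    (A : Matrix (Fin 3) (Fin 3) ℝ) (i j : Fin 3) :
    ⁅∑ k, A k i • V k, ∑ k, A k j • V k⁆ = ∑ k, (2 * colCross A i j k) • V k :=
  lie_milnor hV (fun k => A k i) (fun k => A k j)

theorem sum_levi_smul (V : Module.Basis (Fin 3) ℝ LieAlg) (A : Matrix (Fin 3) (Fin 3) ℝ)
    (i j : Fin 3) : ∑ l, (levi i j l * (![2, 2, 2] : Fin 3 → ℝ) l) • ∑ k, A k l • V k =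
      ∑ k, (2 * ∑ l, levi i j l * A k l) • V k := by
  simp only [Finset.smul_sum, smul_smul]
  rw [Finset.sum_comm]
  refine Finset.sum_congr rfl fun k _ => ?_
  rw [← Finset.sum_smul, Finset.mul_sum]
  congr 1
  refine Finset.sum_congr rfl fun l _ => ?_
  have : (![2, 2, 2] : Fin 3 → ℝ) l = 2 := by fin_cases l <;> rfl
  rw [this]; ring

/-- The image of a Milnor basis under a rotation is a Milnor basis. -/
theorem IsMilnorBasis.rotate {V : Module.Basis (Fin 3) ℝ LieAlg} (hV : IsMilnorBasis ![2, 2, 2] V)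
    {A : Matrix (Fin 3) (Fin 3) ℝ} (hA : A.transpose * A = 1) (hd : A.det = 1) :
    ∃ W : Module.Basis (Fin 3) ℝ LieAlg, IsMilnorBasis ![2, 2, 2] W ∧
      ∀ j, W j = ∑ i, A i j • V i := by
  let W := V.map (Matrix.toLinearEquiv V A (by rw [hd]; exact isUnit_one))
  have hW : ∀ j, W j = ∑ i, A i j • V i := fun j => by
    simp [W, Matrix.toLinearEquiv, Matrix.toLin_self]
  refine ⟨W, fun i j => ?_, hW⟩
  have hadj : A.adjugate = A.transpose := by
    have := Matrix.mul_adjugate A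
    rw [hd, one_smul] at this
    calc A.adjugate = A.transpose * A * A.adjugate := by rw [hA, one_mul]
      _ = A.transpose := by rw [mul_assoc, this, mul_one]
  simp only [hW]
  rw [lie_columns hV, sum_levi_smul]
  simp only [(adjugate_eq_transpose_iff A).1 hadj]

theorem IsMilnorBasis.toMatrix_orthogonal {V W : Module.Basis (Fin 3) ℝ LieAlg}
    (hV : IsMilnorBasis ![2, 2, 2] V) (hW : IsMilnorBasis ![2, 2, 2] W) :
    (V.toMatrix W).transpose * V.toMatrix W = 1 := by
  set A := V.toMatrix W with hA
  have hW' : ∀ j, W j = ∑ i, A i j • V i := fun j => (V.sum_toMatrix_smul_self W j).symm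
  have hdet : A.det ≠ 0 := by
    have : IsUnit A := IsUnit.of_mul_eq_one (W.toMatrix V) (V.toMatrix_mul_toMatrix_flip W)
    exact ((Matrix.isUnit_iff_isUnit_det A).1 this).ne_zero
  have hadj : A.adjugate = A.transpose := by
    refine (adjugate_eq_transpose_iff A).2 fun i j k => ?_
    have h := hW i j
    simp only [hW'] at h
    rw [lie_columns hV, sum_levi_smul] at h
    have h2 := congrArg (fun v => V.repr v k) h
    simp only [V.repr_sum_self] at h2
    linarith
  -- Determinants of adj A = Aᵀ give det² = det in dimension three.
  have h1 : A.det = 1 := by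
    have h := A.det_adjugate
    rw [hadj, Matrix.det_transpose, Fintype.card_fin] at h
    have : A.det * (A.det - 1) = 0 := by linear_combination -h
    exact sub_eq_zero.1 ((mul_eq_zero.1 this).resolve_left hdet)
  rw [← hadj, Matrix.adjugate_mul, h1, one_smul]

theorem bilin_sum (B : LieAlg →ₗ[ℝ] LieAlg →ₗ[ℝ] ℝ) {V : Module.Basis (Fin 3) ℝ LieAlg}
    {t : Fin 3 → ℝ} (hB : ∀ i j, B (V i) (V j) = if i = j then t i else 0) (a b : Fin 3 → ℝ) :
    B (∑ i, a i • V i) (∑ i, b i • V i) = ∑ i, a i * b i * t i := by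
  simp only [map_sum, map_smul, LinearMap.sum_apply, LinearMap.smul_apply, hB, smul_eq_mul,
    mul_ite, mul_zero, Finset.sum_ite_eq', Finset.mem_univ, if_true]
  refine Finset.sum_congr rfl fun i _ => by ring

/-- A symmetric bilinear form is diagonal in some Milnor basis. -/
theorem exists_milnor_diagonal {B : LieAlg →ₗ[ℝ] LieAlg →ₗ[ℝ] ℝ} (symm : ∀ v w, B v w = B w v) :
    ∃ (W : Module.Basis (Fin 3) ℝ LieAlg) (x : Fin 3 → ℝ), IsMilnorBasis ![2, 2, 2] W ∧
      ∀ i j, B (W i) (W j) = if i = j then x i else 0 := by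
  obtain ⟨V, hV⟩ := exists_isMilnorBasis
  let G : Matrix (Fin 3) (Fin 3) ℝ := Matrix.of fun i j => B (V i) (V j)
  have hG : G.IsHermitian := by
    ext i j
    simp [G, symm (V j) (V i)]
  obtain ⟨A, hA, hd, hdiag⟩ : ∃ A : Matrix (Fin 3) (Fin 3) ℝ, A.transpose * A = 1 ∧ A.det = 1 ∧
      A.transpose * G * A = Matrix.diagonal hG.eigenvalues := by
    let U : Matrix (Fin 3) (Fin 3) ℝ := hG.eigenvectorUnitary
    have hU : U.transpose * U = 1 := Unitary.coe_star_mul_self hG.eigenvectorUnitary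
    have hUG : U.transpose * G * U = Matrix.diagonal hG.eigenvalues := by
      have := hG.conjStarAlgAut_star_eigenvectorUnitary
      rw [Unitary.conjStarAlgAut_star_apply] at this
      exact this
    have hdU : U.det * U.det = 1 := by
      have := congrArg Matrix.det hU
      rwa [Matrix.det_mul, Matrix.det_transpose, Matrix.det_one] at this
    rcases mul_self_eq_one_iff.1 hdU with h | h
    · exact ⟨U, hU, h, hUG⟩
    -- In odd dimension a change of sign corrects the determinant, and conjugation does not see it.
    · refine ⟨-U, by simpa using hU, ?_, by simpa using hUG⟩
      rw [Matrix.det_neg, h]; norm_num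
  obtain ⟨W, hW, hWA⟩ := hV.rotate hA hd
  refine ⟨W, hG.eigenvalues, hW, fun i j => ?_⟩
  have h := congrFun (congrFun hdiag i) j
  rw [Matrix.diagonal_apply] at h
  rw [← h, hWA, hWA]
  simp only [map_sum, map_smul, LinearMap.sum_apply, LinearMap.smul_apply, Matrix.mul_apply,
    Finset.sum_mul, Matrix.transpose_apply, smul_eq_mul, G, Matrix.of_apply]
  refine Finset.sum_congr rfl fun k _ => ?_
  rw [Finset.mul_sum]
  exact Finset.sum_congr rfl fun l _ => by ring

/-! ### Diagonal tensor fields, and solutions in diagonal form. -/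

/-- Left-invariant tensor fields agree if they agree on a basis of the Lie algebra. -/
theorem IsLeftInvariant.ext {T T' : TensorField} (hT : IsLeftInvariant T) (hT' : IsLeftInvariant T')
    (V : Module.Basis (Fin 3) ℝ LieAlg) (h : ∀ i j, T 1 (V i) (V j) = T' 1 (V i) (V j)) :
    T = T' := by
  rw [isLeftInvariant_iff] at hT hT'
  have h1 : T 1 = T' 1 := LinearMap.ext_basis V V h
  funext x
  refine LinearMap.ext fun v => LinearMap.ext fun w => ?_
  obtain ⟨v, rfl⟩ := (leftEquiv x).surjective v
  obtain ⟨w, rfl⟩ := (leftEquiv x).surjective w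
  rw [hT, hT', h1]

/-- The left-invariant tensor field that is `diag(x₀, x₁, x₂)` in the basis `V`. -/
def diagField (V : Module.Basis (Fin 3) ℝ LieAlg) (x : Fin 3 → ℝ) : TensorField := fun y =>
  (V.constr ℝ fun i => V.constr ℝ fun j => if i = j then x i else 0 :
    LieAlg →ₗ[ℝ] LieAlg →ₗ[ℝ] ℝ).compl₁₂ (leftEquiv y).symm.toLinearMap
      (leftEquiv y).symm.toLinearMap

theorem diagField_leftEquiv (V : Module.Basis (Fin 3) ℝ LieAlg) (x : Fin 3 → ℝ) (y : SO3)
    (v w : LieAlg) : diagField V x y (leftEquiv y v) (leftEquiv y w) =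
      (V.constr ℝ fun i => V.constr ℝ fun j => if i = j then x i else 0 :
        LieAlg →ₗ[ℝ] LieAlg →ₗ[ℝ] ℝ) v w := by
  simp [diagField]

theorem diagField_one (V : Module.Basis (Fin 3) ℝ LieAlg) (x : Fin 3 → ℝ) (v w : LieAlg) :
    diagField V x 1 v w = (V.constr ℝ fun i => V.constr ℝ fun j => if i = j then x i else 0 :
        LieAlg →ₗ[ℝ] LieAlg →ₗ[ℝ] ℝ) v w := by
  have := diagField_leftEquiv V x 1 v w
  rwa [leftEquiv_one, leftEquiv_one] at this

theorem isLeftInvariant_diagField (V : Module.Basis (Fin 3) ℝ LieAlg) (x : Fin 3 → ℝ) :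
    IsLeftInvariant (diagField V x) := by
  rw [isLeftInvariant_iff]
  intro y v w
  rw [diagField_leftEquiv, diagField_one]

theorem isDiagonalIn_diagField (V : Module.Basis (Fin 3) ℝ LieAlg) (x : Fin 3 → ℝ) :
    IsDiagonalIn (diagField V x) V x := fun i j => by
  rw [diagField_one, Module.Basis.constr_basis, Module.Basis.constr_basis]

theorem isLeftInvariantMetric_diagField (V : Module.Basis (Fin 3) ℝ LieAlg) {x : Fin 3 → ℝ}
    (hx : ∀ i, 0 < x i) : IsLeftInvariantMetric (diagField V x) where
  leftInvariant := isLeftInvariant_diagField V x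
  symm y v w := by
    obtain ⟨v, rfl⟩ := (leftEquiv y).surjective v
    obtain ⟨w, rfl⟩ := (leftEquiv y).surjective w
    have hl := (isLeftInvariant_iff _).1 (isLeftInvariant_diagField V x)
    rw [hl, hl]
    have e1 := (V.sum_repr v).symm
    have e2 := (V.sum_repr w).symm
    rw [e1, e2, bilin_sum _ (isDiagonalIn_diagField V x), bilin_sum _ (isDiagonalIn_diagField V x)]
    exact Finset.sum_congr rfl fun i _ => by ring
  pos y v hv := by
    obtain ⟨v, rfl⟩ := (leftEquiv y).surjective v
    have hl := (isLeftInvariant_iff _).1 (isLeftInvariant_diagField V x)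
    rw [hl]
    have hv0 : v ≠ 0 := fun h => hv (by rw [h, map_zero])
    obtain ⟨i, hi⟩ : ∃ i, V.repr v i ≠ 0 := by
      by_contra! h
      exact hv0 (V.repr.map_eq_zero_iff.1 (Finsupp.ext h))
    rw [← V.sum_repr v, bilin_sum _ (isDiagonalIn_diagField V x)]
    refine Finset.sum_pos' (fun j _ => mul_nonneg (mul_self_nonneg _) (hx j).le)
      ⟨i, Finset.mem_univ i, mul_pos (mul_self_pos.2 hi) (hx i)⟩

theorem IsLeftInvariantMetric.diag_pos {g : TensorField} (hg : IsLeftInvariantMetric g)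
    {V : Module.Basis (Fin 3) ℝ LieAlg} {x : Fin 3 → ℝ} (hx : IsDiagonalIn g V x) (i : Fin 3) :
    0 < x i := by
  have h := hg.pos 1 (V i) (V.ne_zero i)
  rwa [hx, if_pos rfl] at h

theorem isSolution_diagField {T : TensorField} (hT : IsLeftInvariant T)
    {V : Module.Basis (Fin 3) ℝ LieAlg} (hV : IsMilnorBasis ![2, 2, 2] V) {t x : Fin 3 → ℝ}
    (hTV : IsDiagonalIn T V t) (hx : ∀ i, 0 < x i) {c : ℝ} (hc : 0 < c)
    (h : ∀ i, ricciDiag x i = c * t i) : IsSolution T (diagField V x) c where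
  metric := isLeftInvariantMetric_diagField V hx
  pos := hc
  ricci_eq := by
    have hg := isLeftInvariantMetric_diagField V hx
    have hΓ := isAlgLeviCivita_gammaOf hV (fun i => (hx i).ne') (isDiagonalIn_diagField V x)
    have hcov := isLeviCivita_connectionOf hg hΓ
    refine ⟨_, hcov, fun y v w => ?_⟩
    obtain ⟨v, rfl⟩ := (leftEquiv y).surjective v
    obtain ⟨w, rfl⟩ := (leftEquiv y).surjective w
    rw [ricci_leftEquiv hg hcov hΓ, (isLeftInvariant_iff T).1 hT]
    revert w
    revert v
    refine basis_induction V (fun i => basis_induction V (fun j => ?_) ?_ ?_) ?_ ?_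
    · rw [trace_ricciEndo_gammaOf hV (fun i => (hx i).ne'), hTV, h]
      split_ifs <;> simp
    · intro v w hv hw
      have : ricciEndo (gammaOf V x) (V i) (v + w) =
        ricciEndo (gammaOf V x) (V i) v + ricciEndo (gammaOf V x) (V i) w := by
        ext1 u; simp only [LinearMap.add_apply, ricciEndo_apply, map_add]; abel
      rw [this, map_add, map_add, hv, hw]; ring
    · intro a v hv
      have : ricciEndo (gammaOf V x) (V i) (a • v) = a • ricciEndo (gammaOf V x) (V i) v := by
        ext1 u; simp only [LinearMap.smul_apply, ricciEndo_apply, map_smul, smul_sub]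
      rw [this, map_smul, map_smul, hv, smul_eq_mul, smul_eq_mul]; ring
    · intro v w hv hw u
      have : ricciEndo (gammaOf V x) (v + w) u =
        ricciEndo (gammaOf V x) v u + ricciEndo (gammaOf V x) w u := by
        ext1 z; simp only [LinearMap.add_apply, ricciEndo_apply, map_add, lie_add]; abel
      rw [this, map_add, map_add, LinearMap.add_apply, hv, hw]; ring
    · intro a v hv u
      have : ricciEndo (gammaOf V x) (a • v) u = a • ricciEndo (gammaOf V x) v u := by
        ext1 z
        simp only [LinearMap.smul_apply, ricciEndo_apply, map_smul, lie_smul, smul_sub]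
      rw [this, map_smul, map_smul, LinearMap.smul_apply, hv, smul_eq_mul, smul_eq_mul]; ring

/-- Every solution is diagonal together with `T` in some Milnor basis. -/
theorem IsSolution.exists_diagonal {T g : TensorField} {c : ℝ} (h : IsSolution T g c) :
    ∃ (W : Module.Basis (Fin 3) ℝ LieAlg) (x t : Fin 3 → ℝ), IsMilnorBasis ![2, 2, 2] W ∧
      IsDiagonalIn g W x ∧ IsDiagonalIn T W t ∧ (∀ i, 0 < x i) ∧ ∀ i, ricciDiag x i = c * t i := by
  obtain ⟨cov, hcov, hric⟩ := h.ricci_eq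
  obtain ⟨W, x, hW, hgW⟩ := exists_milnor_diagonal (h.metric.symm 1)
  have hx : ∀ i, 0 < x i := h.metric.diag_pos hgW
  have hΓ := isAlgLeviCivita_gammaOf hW (fun i => (hx i).ne') hgW
  have key : ∀ i j, c * T 1 (W i) (W j) = if i = j then ricciDiag x i else 0 := fun i j => by
    have h1 := ricci_leftEquiv h.metric hcov hΓ 1 (W i) (W j)
    rw [trace_ricciEndo_gammaOf hW (fun i => (hx i).ne'), hric, leftEquiv_one, leftEquiv_one] at h1
    exact h1
  have hc := h.pos.ne'
  refine ⟨W, x, fun i => ricciDiag x i / c, hW, hgW, fun i j => ?_, hx, fun i => by field_simp⟩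
  have := key i j
  split_ifs at this ⊢ with hij
  · field_simp; linarith
  · exact (mul_eq_zero.1 this).resolve_left hc

/-! ### The root of the cubic attached to a solution. -/

/-- The root of `fbar` that belongs to the metric `diag(x₀, x₁, x₂)` and the constant `c`. -/
def ricciRoot (x : Fin 3 → ℝ) (c : ℝ) : ℝ :=
  milnorMu x 0 * milnorMu x 1 * milnorMu x 2 / (c * (x 0 * x 1 * x 2))

section RicciRoot

variable {x s : Fin 3 → ℝ} {c : ℝ}

theorem eq_of_ricciDiag_eq (hc : 0 < c) (h : ∀ i, ricciDiag x i = c * s i) :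
    s 0 = 2 * (milnorMu x 1 * milnorMu x 2) / (x 1 * x 2) / c ∧
    s 1 = 2 * (milnorMu x 2 * milnorMu x 0) / (x 2 * x 0) / c ∧
    s 2 = 2 * (milnorMu x 0 * milnorMu x 1) / (x 0 * x 1) / c := by
  have hc' := hc.ne'
  refine ⟨?_, ?_, ?_⟩ <;> rw [eq_div_iff hc', mul_comm, ← h] <;> rfl

theorem fbar_ricciRoot (hx : ∀ i, 0 < x i) (hc : 0 < c) (h : ∀ i, ricciDiag x i = c * s i) :
    fbar (s 0) (s 1) (s 2) (ricciRoot x c) = 0 := by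
  obtain ⟨h0, h1, h2⟩ := eq_of_ricciDiag_eq hc h
  have x0 := (hx 0).ne'
  have x1 := (hx 1).ne'
  have x2 := (hx 2).ne'
  have hc' := hc.ne'
  rw [fbar, h0, h1, h2, ricciRoot]
  field_simp
  simp only [milnorMu]
  ring

theorem mul_prod_eq_ricciRoot_sq (hx : ∀ i, 0 < x i) (hc : 0 < c)
    (h : ∀ i, ricciDiag x i = c * s i) : c * (s 0 * s 1 * s 2) = 8 * ricciRoot x c ^ 2 := by
  obtain ⟨h0, h1, h2⟩ := eq_of_ricciDiag_eq hc h
  have x0 := (hx 0).ne'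
  have x1 := (hx 1).ne'
  have x2 := (hx 2).ne'
  have hc' := hc.ne'
  rw [h0, h1, h2, ricciRoot]
  field_simp
  ring

/-- The root equals μᵢsᵢ/(2xᵢ), and μᵢ + 2xᵢ is the sum of the x's. This recovers the metric, up to
scale, from T and the root. -/
theorem metric_eq_of_ricciDiag (hx : ∀ i, 0 < x i) (hc : 0 < c)
    (h : ∀ i, ricciDiag x i = c * s i) (i : Fin 3) :
    2 * x i * (s i + ricciRoot x c) = (x 0 + x 1 + x 2) * s i := by
  obtain ⟨h0, h1, h2⟩ := eq_of_ricciDiag_eq hc h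
  have x0 := (hx 0).ne'
  have x1 := (hx 1).ne'
  have x2 := (hx 2).ne'
  have hc' := hc.ne'
  fin_cases i
  · simp only [Fin.zero_eta, h0, ricciRoot]
    field_simp
    simp only [milnorMu]
    ring
  · simp only [Fin.mk_one, h1, ricciRoot]
    field_simp
    simp only [milnorMu]
    ring
  · simp only [Fin.reduceFinMk, h2, ricciRoot]
    field_simp
    simp only [milnorMu]
    ring

theorem milnorMu_add (x : Fin 3 → ℝ) : milnorMu x 0 + milnorMu x 1 = 2 * x 2 ∧
    milnorMu x 1 + milnorMu x 2 = 2 * x 0 ∧ milnorMu x 2 + milnorMu x 0 = 2 * x 1 := by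
  simp only [milnorMu]
  refine ⟨?_, ?_, ?_⟩ <;> ring

/-- The possible signatures of the Ricci curvature. -/
theorem ricci_signature (hx : ∀ i, 0 < x i) (hc : 0 < c) (h : ∀ i, ricciDiag x i = c * s i) :
    (0 < ricciRoot x c ∧ ∀ i, 0 < s i) ∨
    (ricciRoot x c = 0 ∧ ∃ i, s i = 8 / c ∧ ∀ j, j ≠ i → s j = 0) ∨
    (ricciRoot x c < 0 ∧ ∃ i, 0 < s i ∧ ∀ j, j ≠ i → s j < 0) := by
  obtain ⟨h0, h1, h2⟩ := eq_of_ricciDiag_eq hc h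
  -- Any two μ's have positive sum, so at most one of them is not positive.
  obtain ⟨m2, m0, m1⟩ := milnorMu_add x
  have x0 := hx 0
  have x1 := hx 1
  have x2 := hx 2
  have hX : 0 < c * (x 0 * x 1 * x 2) := by positivity
  have npp : ∀ a b d : ℝ, a < 0 → 0 < b → 0 < d → a * b * d < 0 := fun a b d ha hb hd =>
    mul_neg_of_neg_of_pos (mul_neg_of_neg_of_pos ha hb) hd
  have neg : ∀ a b d e : ℝ, a * b < 0 → 0 < d → 0 < e → 2 * (a * b) / (d * e) / c < 0 :=
    fun a b d e hab hd he => div_neg_of_neg_of_pos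
      (div_neg_of_neg_of_pos (by linarith) (mul_pos hd he)) hc
  -- If one μ vanishes, the other two are twice the metric coefficients with their indices
  -- exchanged, and 2 · 2 · 2 = 8 remains.
  have eight : ∀ a b d e : ℝ, a = 2 * e → b = 2 * d → 0 < d → 0 < e →
      2 * (a * b) / (d * e) / c = 8 / c := fun a b d e ha hb hd he => by
    rw [ha, hb]; congr 1; field_simp; norm_num
  rcases lt_trichotomy (milnorMu x 0) 0 with l0 | l0 | l0
  · have p1 : 0 < milnorMu x 1 := by linarith
    have p2 : 0 < milnorMu x 2 := by linarith
    refine Or.inr (Or.inr ⟨div_neg_of_neg_of_pos (npp _ _ _ l0 p1 p2) hX, 0, by rw [h0]; positivity,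
      fun j hj => ?_⟩)
    fin_cases j
    · exact absurd rfl hj
    · exact h1 ▸ neg _ _ _ _ (mul_neg_of_pos_of_neg p2 l0) x2 x0
    · exact h2 ▸ neg _ _ _ _ (mul_neg_of_neg_of_pos l0 p1) x0 x1
  · refine Or.inr (Or.inl ⟨by rw [ricciRoot, l0]; simp, 0, ?_, fun j hj => ?_⟩)
    · exact h0.trans (eight _ _ _ _ (by linarith) (by linarith) x1 x2)
    · fin_cases j
      · exact absurd rfl hj
      · exact h1.trans (by rw [l0]; simp)
      · exact h2.trans (by rw [l0]; simp)
  rcases lt_trichotomy (milnorMu x 1) 0 with l1 | l1 | l1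
  · have p2 : 0 < milnorMu x 2 := by linarith
    refine Or.inr (Or.inr ⟨div_neg_of_neg_of_pos ?_ hX, 1, by rw [h1]; positivity,
      fun j hj => ?_⟩)
    · rw [mul_comm (milnorMu x 0)]; exact npp _ _ _ l1 l0 p2
    fin_cases j
    · exact h0 ▸ neg _ _ _ _ (mul_neg_of_neg_of_pos l1 p2) x1 x2
    · exact absurd rfl hj
    · exact h2 ▸ neg _ _ _ _ (mul_neg_of_pos_of_neg l0 l1) x0 x1
  · refine Or.inr (Or.inl ⟨by rw [ricciRoot, l1]; simp, 1, ?_, fun j hj => ?_⟩)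
    · exact h1.trans (eight _ _ _ _ (by linarith) (by linarith) x2 x0)
    · fin_cases j
      · exact h0.trans (by rw [l1]; simp)
      · exact absurd rfl hj
      · exact h2.trans (by rw [l1]; simp)
  rcases lt_trichotomy (milnorMu x 2) 0 with l2 | l2 | l2
  · refine Or.inr (Or.inr ⟨div_neg_of_neg_of_pos (mul_neg_of_pos_of_neg (mul_pos l0 l1) l2) hX, 2,
      by rw [h2]; positivity, fun j hj => ?_⟩)
    fin_cases j
    · exact h0 ▸ neg _ _ _ _ (mul_neg_of_pos_of_neg l1 l2) x1 x2
    · exact h1 ▸ neg _ _ _ _ (mul_neg_of_neg_of_pos l2 l0) x2 x0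
    · exact absurd rfl hj
  · refine Or.inr (Or.inl ⟨by rw [ricciRoot, l2]; simp, 2, ?_, fun j hj => ?_⟩)
    · exact h2.trans (eight _ _ _ _ (by linarith) (by linarith) x0 x1)
    · fin_cases j
      · exact h0.trans (by rw [l2]; simp)
      · exact h1.trans (by rw [l2]; simp)
      · exact absurd rfl hj
  · refine Or.inl ⟨by rw [ricciRoot]; positivity, fun i => ?_⟩
    fin_cases i
    · exact h0 ▸ by positivity
    · exact h1 ▸ by positivity
    · exact h2 ▸ by positivity

end RicciRoot

/-! ### Comparison with a prescribed Milnor basis, and ordering of the entries. -/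

/-- The diagonalizing Milnor basis of a solution compared with a given Milnor basis in which `T` is
diagonal. -/
theorem IsSolution.compare {T g : TensorField} {c : ℝ} (h : IsSolution T g c)
    {V : Module.Basis (Fin 3) ℝ LieAlg} (hV : IsMilnorBasis ![2, 2, 2] V) {t : Fin 3 → ℝ}
    (hTV : IsDiagonalIn T V t) :
    ∃ x s : Fin 3 → ℝ, (∀ i, 0 < x i) ∧ (∀ i, ricciDiag x i = c * s i) ∧ (∀ j, ∃ a, s j = t a) ∧
      (∀ a, ∃ j, t a = s j) ∧ s 0 + s 1 + s 2 = t 0 + t 1 + t 2 ∧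
      s 0 * s 1 * s 2 = t 0 * t 1 * t 2 ∧
      ∀ f : ℝ → ℝ, (∀ j, x j = f (s j)) → IsDiagonalIn g V fun a => f (t a) := by
  obtain ⟨W, x, s, hW, hgW, hTW, hx, hr⟩ := h.exists_diagonal
  set A := W.toMatrix V with hA
  have hO : A.transpose * A = 1 := hW.toMatrix_orthogonal hV
  have hO' : A * A.transpose = 1 := mul_eq_one_comm.1 hO
  have hVA : ∀ a, V a = ∑ j, A j a • W j := fun a => (W.sum_toMatrix_smul_self V a).symm
  have hD : A.transpose * Matrix.diagonal s * A = Matrix.diagonal t := by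
    ext a b
    rw [Matrix.diagonal_apply, ← hTV a b, hVA, hVA, bilin_sum _ hTW]
    rw [Matrix.mul_apply]
    simp only [Matrix.mul_diagonal, Matrix.transpose_apply]
    exact Finset.sum_congr rfl fun j _ => by ring
  have hAD : Matrix.diagonal s * A = A * Matrix.diagonal t := by
    rw [← hD, ← mul_assoc, ← mul_assoc, hO', one_mul]
  -- A intertwines the two diagonal forms, so it mixes only equal eigenvalues. Hence a metric with
  -- coefficients f(sⱼ) stays diagonal in V even when T has repeated entries.
  have hst : ∀ j a, A j a ≠ 0 → s j = t a := fun j a hja => by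
    have := congrFun (congrFun hAD j) a
    rw [Matrix.diagonal_mul, Matrix.mul_diagonal, mul_comm] at this
    exact mul_left_cancel₀ hja this
  refine ⟨x, s, hx, hr, fun j => ?_, fun a => ?_, ?_, ?_, fun f hf a b => ?_⟩
  · by_contra! hne
    have h0 : ∀ a, A j a = 0 := fun a => by_contra fun hja => hne a (hst j a hja)
    have := congrFun (congrFun hO' j) j
    simp [Matrix.mul_apply, h0] at this
  · by_contra! hne
    have h0 : ∀ j, A j a = 0 := fun j => by_contra fun hja => hne j (hst j a hja).symm
    have := congrFun (congrFun hO a) a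
    simp [Matrix.mul_apply, h0] at this
  · have := congrArg Matrix.trace hD
    rw [mul_assoc, Matrix.trace_mul_comm, mul_assoc, hO', mul_one] at this
    simpa [Matrix.trace_diagonal, Fin.sum_univ_three] using this
  · have := congrArg Matrix.det hD
    rw [mul_assoc, Matrix.det_mul_comm, mul_assoc, hO', mul_one] at this
    simpa [Matrix.det_diagonal, Fin.prod_univ_three] using this
  · rw [hVA, hVA, bilin_sum _ hgW]
    have e : ∀ j, A j a * A j b * x j = A j a * A j b * f (t b) := fun j => by
      by_cases hjb : A j b = 0
      · rw [hjb]; ring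
      · rw [hf, hst j b hjb]
    simp only [e]
    rw [← Finset.sum_mul]
    have := congrFun (congrFun hO a) b
    simp only [Matrix.mul_apply, Matrix.transpose_apply, Matrix.one_apply] at this
    rw [this]
    split_ifs with hab
    · rw [hab, one_mul]
    · rw [zero_mul]

/-- The diagonal entries of `T` in a Milnor basis can be put in decreasing order. -/
theorem exists_milnor_antitone {T : TensorField} {W : Module.Basis (Fin 3) ℝ LieAlg}
    (hW : IsMilnorBasis ![2, 2, 2] W) {t : Fin 3 → ℝ} (hTW : IsDiagonalIn T W t) :
    ∃ (V : Module.Basis (Fin 3) ℝ LieAlg) (T₁ T₂ T₃ : ℝ), IsMilnorBasis ![2, 2, 2] V ∧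
      IsDiagonalIn T V ![T₁, T₂, T₃] ∧ T₂ ≤ T₁ ∧ T₃ ≤ T₂ := by
  let Q : ℝ → ℝ → ℝ → Prop := fun a b d => ∃ V : Module.Basis (Fin 3) ℝ LieAlg,
    IsMilnorBasis ![2, 2, 2] V ∧ IsDiagonalIn T V ![a, b, d]
  have swap₁ : ∀ a b d, Q a b d → Q b a d := by
    rintro a b d ⟨V, hV, hTV⟩
    -- A transposition has determinant -1, so all three vectors change sign; a diagonal form is
    -- unaffected.
    obtain ⟨V', hV', hA⟩ := hV.rotate (A := !![0, -1, 0; -1, 0, 0; 0, 0, -1])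
      (by ext i j; fin_cases i <;> fin_cases j <;> simp [Matrix.mul_apply, Fin.sum_univ_three])
      (by simp [Matrix.det_fin_three])
    refine ⟨V', hV', fun i j => ?_⟩
    rw [hA, hA, bilin_sum _ hTV]
    fin_cases i <;> fin_cases j <;> simp [Fin.sum_univ_three]
  have swap₂ : ∀ a b d, Q a b d → Q a d b := by
    rintro a b d ⟨V, hV, hTV⟩
    obtain ⟨V', hV', hA⟩ := hV.rotate (A := !![-1, 0, 0; 0, 0, -1; 0, -1, 0])
      (by ext i j; fin_cases i <;> fin_cases j <;> simp [Matrix.mul_apply, Fin.sum_univ_three])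
      (by simp [Matrix.det_fin_three])
    refine ⟨V', hV', fun i j => ?_⟩
    rw [hA, hA, bilin_sum _ hTV]
    fin_cases i <;> fin_cases j <;> simp [Fin.sum_univ_three]
  have hQ : Q (t 0) (t 1) (t 2) := ⟨W, hW, by
    convert hTW using 1
    ext i; fin_cases i <;> rfl⟩
  have sorted : ∀ a b d, Q a b d → b ≤ a → ∃ a' b' d', Q a' b' d' ∧ b' ≤ a' ∧ d' ≤ b' := by
    intro a b d h hab
    rcases le_total d b with h1 | h1
    · exact ⟨a, b, d, h, hab, h1⟩
    rcases le_total d a with h2 | h2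
    · exact ⟨a, d, b, swap₂ _ _ _ h, h2, h1⟩
    · exact ⟨d, a, b, swap₁ _ _ _ (swap₂ _ _ _ h), h2, hab⟩
  obtain ⟨a, b, d, ⟨V, hV, hTV⟩, h1, h2⟩ := (le_total (t 1) (t 0)).elim (sorted _ _ _ hQ)
    (sorted _ _ _ (swap₁ _ _ _ hQ))
  exact ⟨V, a, b, d, hV, hTV, h1, h2⟩

/-! ### Real roots of the cubic. -/

theorem continuous_fbar (T₁ T₂ T₃ : ℝ) : Continuous (fbar T₁ T₂ T₃) := by
  unfold fbar; fun_prop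

/-- Two different roots of `fbar` satisfy a quadratic relation. -/
theorem fbar_roots {T₁ T₂ T₃ p q : ℝ} (hp : fbar T₁ T₂ T₃ p = 0) (hq : fbar T₁ T₂ T₃ q = 0)
    (hpq : p ≠ q) : 2 * (p ^ 2 + p * q + q ^ 2) + (T₁ + T₂ + T₃) * (p + q) = 0 := by
  simp only [fbar] at hp hq
  have : (p - q) * (2 * (p ^ 2 + p * q + q ^ 2) + (T₁ + T₂ + T₃) * (p + q)) = 0 := by
    linear_combination hp - hq
  exact (mul_eq_zero.1 this).resolve_left (sub_ne_zero.2 hpq)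

theorem fbar_pos_root_unique {T₁ T₂ T₃ p q : ℝ} (h : 0 < T₁ + T₂ + T₃) (hp : fbar T₁ T₂ T₃ p = 0)
    (hq : fbar T₁ T₂ T₃ q = 0) (p0 : 0 < p) (q0 : 0 < q) : p = q := by
  by_contra hpq
  have := fbar_roots hp hq hpq
  have : 0 < 2 * (p ^ 2 + p * q + q ^ 2) + (T₁ + T₂ + T₃) * (p + q) := by positivity
  linarith

/-- `fbar` has at most two negative roots. -/
theorem fbar_neg_roots {T₁ T₂ T₃ p q r : ℝ} (hp : fbar T₁ T₂ T₃ p = 0) (hq : fbar T₁ T₂ T₃ q = 0)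
    (hr : fbar T₁ T₂ T₃ r = 0) (p0 : p < 0) (q0 : q < 0) (r0 : r < 0) (hpq : p ≠ q) :
    r = p ∨ r = q := by
  by_contra! hne
  have h1 := fbar_roots hp hq hpq
  have h2 := fbar_roots hp hr hne.1.symm
  have h3 : (q - r) * (2 * (p + q + r) + (T₁ + T₂ + T₃)) = 0 := by linear_combination h1 - h2
  have h4 := (mul_eq_zero.1 h3).resolve_left (sub_ne_zero.2 hne.2.symm)
  -- The cubic has no linear term, so the second symmetric function of three distinct roots
  -- vanishes; for three negative numbers it is positive.
  have h5 : p * q + p * r + q * r = 0 := by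
    linear_combination (-1 / 2) * h1 + (1 / 2) * (p + q) * h4
  have := mul_pos_of_neg_of_neg p0 q0
  have := mul_pos_of_neg_of_neg p0 r0
  have := mul_pos_of_neg_of_neg q0 r0
  linarith

/-- Taylor expansion at the critical point -(T₁ + T₂ + T₃)/3, where the linear term is missing. -/
theorem fbar_eq (T₁ T₂ T₃ p : ℝ) : fbar T₁ T₂ T₃ p =
    fbar T₁ T₂ T₃ (-(T₁ + T₂ + T₃) / 3) +
      (p + (T₁ + T₂ + T₃) / 3) ^ 2 * (2 * p - (T₁ + T₂ + T₃) / 3) := by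
  simp only [fbar]; ring

theorem fbar_neg_self (T₁ T₂ T₃ : ℝ) : fbar T₁ T₂ T₃ (-T₁) = -(T₁ * (T₁ - T₂) * (T₁ - T₃)) := by
  simp only [fbar]; ring

/-! ### Correspondence between solutions and admissible roots. -/

variable {T g : TensorField} {c p : ℝ} {V : Module.Basis (Fin 3) ℝ LieAlg} {t : Fin 3 → ℝ}

/-- The metric that belongs to a root of `fbar`. -/
theorem isSolution_of_root (hT : IsLeftInvariant T) (hV : IsMilnorBasis ![2, 2, 2] V)
    (hTV : IsDiagonalIn T V t) (hp : fbar (t 0) (t 1) (t 2) p = 0) (p0 : p ≠ 0)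
    (he : 0 < t 0 * t 1 * t 2) (hpos : ∀ i, 0 < t i / (t i + p)) :
    IsSolution T (diagField V fun i => t i / (t i + p)) (8 * p ^ 2 / (t 0 * t 1 * t 2)) := by
  have hn : ∀ i, t i + p ≠ 0 := fun i h => by
    have := hpos i
    rw [h, div_zero] at this
    exact lt_irrefl _ this
  have ht : ∀ i, t i ≠ 0 := fun i h => by
    have := hpos i
    rw [h, zero_div] at this
    exact lt_irrefl _ this
  have n0 := hn 0
  have n1 := hn 1
  have n2 := hn 2
  have t0 := ht 0
  have t1 := ht 1
  have t2 := ht 2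
  -- Clearing denominators turns this into fbar(p) = 0. It normalizes the metric to trace 2, which
  -- makes the μ's simple.
  have hsum : t 0 / (t 0 + p) + t 1 / (t 1 + p) + t 2 / (t 2 + p) = 2 := by
    simp only [fbar] at hp
    field_simp
    linear_combination -hp
  have hmu : ∀ i, milnorMu (fun i => t i / (t i + p)) i = 2 * p / (t i + p) := fun i => by
    have := hn i
    simp only [milnorMu, hsum]
    field_simp
    ring
  refine isSolution_diagField hT hV hTV hpos (by positivity) fun i => ?_
  fin_cases i <;> simp [ricciDiag, hmu] <;> field_simp <;> norm_num

/-- Every solution comes from a root of `fbar`. -/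
theorem IsSolution.exists_root (h : IsSolution T g c) (hV : IsMilnorBasis ![2, 2, 2] V)
    (hTV : IsDiagonalIn T V t) (he : 0 < t 0 * t 1 * t 2) :
    ∃ p, fbar (t 0) (t 1) (t 2) p = 0 ∧ c = 8 * p ^ 2 / (t 0 * t 1 * t 2) ∧
      ((0 < p ∧ ∀ a, 0 < t a) ∨ (p < 0 ∧ (∃ a, t a < 0) ∧ ∃ a, 0 < t a ∧ 0 < t a + p)) ∧
      ((∀ i, t i + p ≠ 0) → Homothetic (diagField V fun i => t i / (t i + p)) g) := by
  obtain ⟨x, s, hx, hr, hst, hts, h1, h3, hf⟩ := h.compare hV hTV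
  have hS : 0 < x 0 + x 1 + x 2 := by linarith [hx 0, hx 1, hx 2]
  have hm := metric_eq_of_ricciDiag hx h.pos hr
  have hroot := fbar_ricciRoot hx h.pos hr
  have hsq := mul_prod_eq_ricciRoot_sq hx h.pos hr
  have hsig := ricci_signature hx h.pos hr
  set p := ricciRoot x c
  refine ⟨p, ?_, ?_, ?_, fun hn => ?_⟩
  -- The cubic involves the entries only through their sum and product, so it is the same for s and
  -- t.
  · simp only [fbar] at hroot ⊢
    rw [← h1, ← h3]; exact hroot
  · rw [← hsq, h3]; exact (mul_div_cancel_right₀ c he.ne').symm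
  · rcases hsig with ⟨hp, hs⟩ | ⟨hp, _⟩ | ⟨hp, i, hi, hj⟩
    · refine Or.inl ⟨hp, fun a => ?_⟩
      obtain ⟨j, hj⟩ := hts a
      rw [hj]; exact hs j
    · rw [hp, h3] at hsq
      have := mul_pos h.pos he
      rw [hsq] at this
      norm_num at this
    · refine Or.inr ⟨hp, ?_, ?_⟩
      -- Addition is modulo 3, so i + 1 is an index different from i.
      · obtain ⟨a, ha⟩ := hst (i + 1)
        exact ⟨a, ha ▸ hj (i + 1) (by fin_cases i <;> decide)⟩
      · obtain ⟨a, ha⟩ := hst i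
        refine ⟨a, ha ▸ hi, ?_⟩
        have : 0 < 2 * x i * (s i + p) := by rw [hm i]; exact mul_pos hS hi
        rw [← ha]
        exact (mul_pos_iff_of_pos_left (by linarith [hx i])).1 this
  · refine ⟨(x 0 + x 1 + x 2) / 2, by positivity, ?_⟩
    -- The metric coefficients are a function of the eigenvalues of T alone, so the comparison of
    -- bases determines g in V.
    have hd := hf (fun u => (x 0 + x 1 + x 2) / 2 * (u / (u + p))) fun j => by
      have hsj : s j + p ≠ 0 := by
        obtain ⟨a, ha⟩ := hst j
        rw [ha]; exact hn a
      have := hm j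
      field_simp
      linarith
    refine h.metric.leftInvariant.ext ?_ V fun i j => ?_
    · intro a y v w
      have := isLeftInvariant_diagField V (fun i => t i / (t i + p)) a y v w
      exact congrArg (fun r => (x 0 + x 1 + x 2) / 2 * r) this
    · rw [hd i j]
      have := isDiagonalIn_diagField V (fun i => t i / (t i + p)) i j
      refine Eq.trans ?_ (congrArg (fun r => (x 0 + x 1 + x 2) / 2 * r) this.symm)
      split_ifs <;> simp

/-- If exactly one root of `fbar` is admissible, there is exactly one solution. -/
theorem hasUniqueSolution_of_root (hT : IsLeftInvariant T) (hV : IsMilnorBasis ![2, 2, 2] V)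
    (hTV : IsDiagonalIn T V t) (he : 0 < t 0 * t 1 * t 2)
    (hp : fbar (t 0) (t 1) (t 2) p = 0) (p0 : p ≠ 0) (hpos : ∀ i, 0 < t i / (t i + p))
    (huniq : ∀ q, fbar (t 0) (t 1) (t 2) q = 0 → ((0 < q ∧ ∀ a, 0 < t a) ∨
      (q < 0 ∧ (∃ a, t a < 0) ∧ ∃ a, 0 < t a ∧ 0 < t a + q)) → q = p) : HasUniqueSolution T := by
  refine ⟨_, _, isSolution_of_root hT hV hTV hp p0 he hpos, fun g c h => ?_⟩
  obtain ⟨q, hq, hc, hs, hh⟩ := h.exists_root hV hTV he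
  obtain rfl := huniq q hq hs
  refine ⟨hh fun i h0 => ?_, hc⟩
  have := hpos i
  rw [h0, div_zero] at this
  exact lt_irrefl _ this

/-! ### The three cases, and necessity of the conditions. -/

section Cases

variable {T : TensorField} {V : Module.Basis (Fin 3) ℝ LieAlg} {T₁ T₂ T₃ : ℝ}

theorem CaseI.hasUniqueSolution (h : CaseI T₁ T₂ T₃) (hT : IsLeftInvariant T)
    (hV : IsMilnorBasis ![2, 2, 2] V) (hTV : IsDiagonalIn T V ![T₁, T₂, T₃]) :
    HasUniqueSolution T := by
  obtain ⟨h12, h23, h3⟩ := h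
  have h2 : 0 < T₂ := by linarith
  have h1 : 0 < T₁ := by linarith
  have hE : 0 < T₁ + T₂ + T₃ := by positivity
  have he : 0 < T₁ * T₂ * T₃ := by positivity
  -- With E = T₁ + T₂ + T₃, the cubic is negative at 0, and at E it is 3E³ - T₁T₂T₃ > 0, since each
  -- Tᵢ is at most E.
  obtain ⟨p, hpI, hp⟩ : (0 : ℝ) ∈ fbar T₁ T₂ T₃ '' Set.Ioo 0 (T₁ + T₂ + T₃) := by
    refine intermediate_value_Ioo hE.le (continuous_fbar _ _ _).continuousOn ⟨?_, ?_⟩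
    · simp only [fbar]; linarith
    · have : fbar T₁ T₂ T₃ (T₁ + T₂ + T₃) = 3 * (T₁ + T₂ + T₃) ^ 3 - T₁ * T₂ * T₃ := by
        simp only [fbar]; ring
      rw [this]
      have e : (T₁ + T₂ + T₃) ^ 3 = (T₁ + T₂ + T₃) * (T₁ + T₂ + T₃) * (T₁ + T₂ + T₃) := by ring
      have : T₁ * T₂ * T₃ ≤ (T₁ + T₂ + T₃) ^ 3 := by
        rw [e]; gcongr <;> linarith
      have : 0 < (T₁ + T₂ + T₃) ^ 3 := by positivity
      linarith
  have p0 := hpI.1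
  refine hasUniqueSolution_of_root hT hV hTV he hp p0.ne' (fun i => ?_) fun q hq hs => ?_
  · fin_cases i <;> simp <;> positivity
  · rcases hs with ⟨hq0, _⟩ | ⟨_, ⟨a, ha⟩, _⟩
    · exact fbar_pos_root_unique hE hq hp hq0 p0
    · fin_cases a <;> simp at ha <;> linarith

theorem CaseII.hasInfinitelyManySolutions (h : CaseII T₁ T₂ T₃) (hT : IsLeftInvariant T)
    (hV : IsMilnorBasis ![2, 2, 2] V) (hTV : IsDiagonalIn T V ![T₁, T₂, T₃]) :
    HasInfinitelyManySolutionsWith T (8 / T₁) := by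
  obtain ⟨h1, rfl, rfl⟩ := h
  -- These metrics satisfy x₀ = x₁ + x₂, so μ₀ = 0 and the Ricci tensor is diag(8, 0, 0). The last
  -- entry 1 rules out homotheties.
  refine ⟨⟨fun n => diagField V ![(n : ℝ) + 2, n + 1, 1], fun n => ?_, fun m n hmn hh => ?_⟩,
    fun g c hs => ?_⟩
  · refine isSolution_diagField hT hV hTV (fun i => ?_) (by positivity) fun i => ?_
    · fin_cases i <;> simp <;> positivity
    · have : (n : ℝ) + 1 ≠ 0 := by positivity
      have hm : milnorMu ![(n : ℝ) + 2, n + 1, 1] 0 = 0 := by simp [milnorMu]; ring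
      fin_cases i
      · simp [ricciDiag, milnorMu]; field_simp; ring
      · simp [ricciDiag, hm]
      · simp [ricciDiag, hm]
  · obtain ⟨k, _, hk⟩ := hh
    have e : ∀ i, (![(n : ℝ) + 2, n + 1, 1] : Fin 3 → ℝ) i =
        k * (![(m : ℝ) + 2, m + 1, 1] : Fin 3 → ℝ) i := fun i => by
      have h1 := isDiagonalIn_diagField V ![(n : ℝ) + 2, n + 1, 1] i i
      have h2 := isDiagonalIn_diagField V ![(m : ℝ) + 2, m + 1, 1] i i
      rw [if_pos rfl] at h1 h2
      have hk' : diagField V ![(n : ℝ) + 2, n + 1, 1] = k • diagField V ![(m : ℝ) + 2, m + 1, 1] := hk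
      rw [← h1, ← h2, hk']
      rfl
    have e1 := e 1
    have e2 := e 2
    simp at e1 e2
    rw [← e2, one_mul, add_left_inj] at e1
    exact hmn (Nat.cast_injective e1).symm
  · obtain ⟨x, s, hx, hr, hst, hts, _, h3, _⟩ := hs.compare hV hTV
    have hsq := mul_prod_eq_ricciRoot_sq hx hs.pos hr
    rw [h3] at hsq
    have hp : ricciRoot x c = 0 := by simpa using hsq
    rcases ricci_signature hx hs.pos hr with ⟨h, _⟩ | ⟨_, i, hi, _⟩ | ⟨h, _⟩
    · exact absurd hp h.ne'
    · obtain ⟨a, ha⟩ := hst i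
      rw [hi] at ha
      have h8 : 0 < 8 / c := div_pos (by norm_num) hs.pos
      have hc := hs.pos.ne'
      fin_cases a <;> simp at ha
      · rw [← ha]; field_simp
      · exact absurd ha hc
      · exact absurd ha hc
    · exact absurd hp h.ne

/-- In the third case, the admissible roots are those in `(-T₁, 0)`. -/
theorem CaseIII.facts (h : CaseIII T₁ T₂ T₃) : 0 < T₁ ∧ T₂ < 0 ∧ T₃ < 0 ∧ 0 < T₁ * T₂ * T₃ ∧
    fbar T₁ T₂ T₃ (-T₁) < 0 ∧ 0 < T₁ + T₂ + T₃ ∧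
    0 ≤ fbar T₁ T₂ T₃ (-(T₁ + T₂ + T₃) / 3) := by
  obtain ⟨h1, h32, h2, hd⟩ := h
  have h3 : T₃ < 0 := by linarith
  have hf : fbar T₁ T₂ T₃ (-T₁) < 0 := by
    rw [fbar_neg_self]
    have : 0 < T₁ * (T₁ - T₂) * (T₁ - T₃) := mul_pos (mul_pos h1 (by linarith)) (by linarith)
    linarith
  rcases hd with ⟨hd1, hd2⟩ | hd
  · exact ⟨h1, h2, h3, mul_pos_of_neg_of_neg (mul_neg_of_pos_of_neg h1 h2) h3, hf, by linarith, hd1⟩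
  -- The alternative fbar(-T₁) > 0 never occurs, by `hf`.
  · linarith

theorem div_add_pos_of_root (h1 : 0 < T₁) (h2 : T₂ < 0) (h3 : T₃ < 0) {p : ℝ} (p0 : p < 0)
    (hp : -T₁ < p) (i : Fin 3) :
    0 < (![T₁, T₂, T₃] : Fin 3 → ℝ) i / ((![T₁, T₂, T₃] : Fin 3 → ℝ) i + p) := by
  fin_cases i
  · exact div_pos h1 (by simp; linarith)
  · exact div_pos_of_neg_of_neg h2 (by simp; linarith)
  · exact div_pos_of_neg_of_neg h3 (by simp; linarith)

theorem mem_Ioo_of_admissible (h2 : T₂ < 0) (h3 : T₃ < 0) {q : ℝ}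
    (hs : (0 < q ∧ ∀ a, 0 < (![T₁, T₂, T₃] : Fin 3 → ℝ) a) ∨
      (q < 0 ∧ (∃ a, (![T₁, T₂, T₃] : Fin 3 → ℝ) a < 0) ∧
        ∃ a, 0 < (![T₁, T₂, T₃] : Fin 3 → ℝ) a ∧ 0 < (![T₁, T₂, T₃] : Fin 3 → ℝ) a + q)) :
    -T₁ < q ∧ q < 0 := by
  rcases hs with ⟨_, ha⟩ | ⟨hq, _, a, ha, haq⟩
  · exact absurd (ha 1) h2.not_gt
  · refine ⟨?_, hq⟩
    fin_cases a <;> simp at ha haq <;> linarith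

/-- The local maximum has value 0, so its location -E/3, with E = T₁ + T₂ + T₃ > 0, is a double
root. By `fbar_eq` the only other root is E/6, which is positive and not admissible. -/
theorem CaseIII.hasUniqueSolution (h : CaseIII T₁ T₂ T₃) (hn : ¬ Exceptional T₁ T₂ T₃)
    (hT : IsLeftInvariant T) (hV : IsMilnorBasis ![2, 2, 2] V)
    (hTV : IsDiagonalIn T V ![T₁, T₂, T₃]) : HasUniqueSolution T := by
  obtain ⟨h1, h2, h3, he, hf, hE, hm⟩ := h.facts
  have hm0 : fbar T₁ T₂ T₃ (-(T₁ + T₂ + T₃) / 3) = 0 :=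
    le_antisymm (not_lt.1 fun hlt => hn ⟨hf, by linarith, hlt⟩) hm
  refine hasUniqueSolution_of_root hT hV hTV he hm0 (by linarith)
    (div_add_pos_of_root h1 h2 h3 (by linarith) (by linarith)) fun q hq hs => ?_
  have hq0 := (mem_Ioo_of_admissible h2 h3 hs).2
  have hq' : fbar T₁ T₂ T₃ q = 0 := hq
  rw [fbar_eq, hm0, zero_add] at hq'
  have := pow_eq_zero_iff (two_ne_zero) |>.1 ((mul_eq_zero.1 hq').resolve_right (by linarith))
  linarith

/-- The cubic is negative at -T₁ and at 0 and positive at its local maximum, giving one root on each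
side. Both are negative and distinct, so their squares, and with them the constants c, differ. -/
theorem CaseIII.hasExactlyTwoSolutions (h : CaseIII T₁ T₂ T₃) (hx : Exceptional T₁ T₂ T₃)
    (hT : IsLeftInvariant T) (hV : IsMilnorBasis ![2, 2, 2] V)
    (hTV : IsDiagonalIn T V ![T₁, T₂, T₃]) : HasExactlyTwoSolutions T := by
  obtain ⟨h1, h2, h3, he, hf, hE, _⟩ := h.facts
  obtain ⟨_, _, hm⟩ := hx
  obtain ⟨p, hpI, hp⟩ : (0 : ℝ) ∈ fbar T₁ T₂ T₃ '' Set.Ioo (-T₁) (-(T₁ + T₂ + T₃) / 3) :=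
    intermediate_value_Ioo (by linarith) (continuous_fbar _ _ _).continuousOn ⟨hf, hm⟩
  obtain ⟨q, hqI, hq⟩ : (0 : ℝ) ∈ fbar T₁ T₂ T₃ '' Set.Ioo (-(T₁ + T₂ + T₃) / 3) 0 := by
    refine intermediate_value_Ioo' (by linarith) (continuous_fbar _ _ _).continuousOn ⟨?_, hm⟩
    simp only [fbar]; linarith
  obtain ⟨hp1, hp2⟩ := hpI
  obtain ⟨hq1, hq2⟩ := hqI
  have hposp := div_add_pos_of_root h1 h2 h3 (p := p) (by linarith) hp1
  have hposq := div_add_pos_of_root h1 h2 h3 (p := q) hq2 (by linarith)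
  have hne : ∀ r, (∀ i, 0 < (![T₁, T₂, T₃] : Fin 3 → ℝ) i / ((![T₁, T₂, T₃] : Fin 3 → ℝ) i + r)) →
      ∀ i, (![T₁, T₂, T₃] : Fin 3 → ℝ) i + r ≠ 0 := fun r hr i h0 => by
    have := hr i
    rw [h0, div_zero] at this
    exact lt_irrefl _ this
  refine ⟨_, _, _, _, isSolution_of_root hT hV hTV hp (by linarith) he hposp,
    isSolution_of_root hT hV hTV hq hq2.ne he hposq, fun heq => ?_, fun g c hs => ?_⟩
  · have h8 := (div_left_inj' he.ne').1 heq
    have : (p - q) * (p + q) = 0 := by linear_combination h8 / 8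
    rcases mul_eq_zero.1 this with h0 | h0 <;> linarith
  · obtain ⟨r, hr, hc, hsg, hh⟩ := hs.exists_root hV hTV he
    have hr0 := (mem_Ioo_of_admissible h2 h3 hsg).2
    rcases fbar_neg_roots hp hq hr (by linarith) hq2 hr0 (by linarith) with rfl | rfl
    · exact Or.inl ⟨hh (hne _ hposp), hc⟩
    · exact Or.inr ⟨hh (hne _ hposq), hc⟩

/-- The sign conditions are necessary. -/
theorem IsSolution.cases {g : TensorField} {c : ℝ} (h : IsSolution T g c)
    (hV : IsMilnorBasis ![2, 2, 2] V) (hTV : IsDiagonalIn T V ![T₁, T₂, T₃])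
    (h12 : T₂ ≤ T₁) (h23 : T₃ ≤ T₂) :
    CaseI T₁ T₂ T₃ ∨ CaseII T₁ T₂ T₃ ∨ CaseIII T₁ T₂ T₃ := by
  obtain ⟨x, s, hx, hr, hst, hts, h1, h3, _⟩ := h.compare hV hTV
  have hroot := fbar_ricciRoot hx h.pos hr
  have hsq := mul_prod_eq_ricciRoot_sq hx h.pos hr
  have hfb : fbar T₁ T₂ T₃ (ricciRoot x c) = 0 := by
    simp only [fbar] at hroot ⊢
    change _ = T₁ + T₂ + T₃ at h1
    change _ = T₁ * T₂ * T₃ at h3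
    rw [← h1, ← h3]; exact hroot
  rcases ricci_signature hx h.pos hr with ⟨_, hs⟩ | ⟨_, i, hi, hj⟩ | ⟨hp, i, hi, hj⟩
  · obtain ⟨j, hj⟩ := hts 2
    exact Or.inl ⟨h12, h23, hj.trans_gt (hs j)⟩
  · have h8 : 0 < 8 / c := div_pos (by norm_num) h.pos
    have hv : ∀ a, (![T₁, T₂, T₃] : Fin 3 → ℝ) a = 8 / c ∨
        (![T₁, T₂, T₃] : Fin 3 → ℝ) a = 0 := fun a => by
      obtain ⟨j, hja⟩ := hts a
      by_cases hji : j = i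
      · exact Or.inl (by rw [hja, hji, hi])
      · exact Or.inr (by rw [hja, hj j hji])
    have hsum : s 0 + s 1 + s 2 = 8 / c := by
      have := Fin.sum_univ_three s
      rw [← this, Finset.sum_eq_single i (fun j _ => hj j) (by simp), hi]
    have hsum' : T₁ + T₂ + T₃ = 8 / c := by rw [← hsum, h1]; rfl
    have v1 : T₁ = 8 / c ∨ T₁ = 0 := hv 0
    have v2 : T₂ = 8 / c ∨ T₂ = 0 := hv 1
    have v3 : T₃ = 8 / c ∨ T₃ = 0 := hv 2
    refine Or.inr (Or.inl ?_)
    -- The sum 8/c allows exactly one nonzero entry, and the ordering makes it the first.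
    rcases v1 with v1 | v1 <;> rcases v2 with v2 | v2 <;> rcases v3 with v3 | v3 <;>
      first
      | exact ⟨by linarith, v2, v3⟩
      | (exfalso; linarith)
  · have he : 0 < T₁ * T₂ * T₃ := by
      have h3' : s 0 * s 1 * s 2 = T₁ * T₂ * T₃ := h3
      rw [← h3']
      have : 0 < c * (s 0 * s 1 * s 2) := by
        rw [hsq]; have := hp.ne; positivity
      exact (mul_pos_iff_of_pos_left h.pos).1 this
    have hT1 : 0 < T₁ := by
      obtain ⟨a, ha⟩ := hst i
      rw [ha] at hi
      fin_cases a <;> simp at hi <;> linarith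
    have hT3 : T₃ < 0 := by
      obtain ⟨a, ha⟩ := hst (i + 1)
      have hn := hj (i + 1) (by fin_cases i <;> decide)
      rw [ha] at hn
      fin_cases a <;> simp at hn <;> linarith
    have hT2 : T₂ < 0 := by
      by_contra! h2
      have := mul_nonpos_of_nonneg_of_nonpos (mul_nonneg hT1.le h2) hT3.le
      linarith
    have hE : 0 < T₁ + T₂ + T₃ := by
      -- For a negative root p, positivity of p²(2p + E) with E = T₁ + T₂ + T₃ forces E > -2p > 0.
      have e : ricciRoot x c ^ 2 * (2 * ricciRoot x c + (T₁ + T₂ + T₃)) = T₁ * T₂ * T₃ := by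
        simp only [fbar] at hfb; linear_combination hfb
      have hp2 : 0 < ricciRoot x c ^ 2 := by have := hp.ne; positivity
      have := (mul_pos_iff_of_pos_left hp2).1 (e ▸ he)
      linarith
    refine Or.inr (Or.inr ⟨hT1, h23, hT2, Or.inl ⟨?_, by linarith⟩⟩)
    -- At a negative root the second summand of `fbar_eq` is at most 0, so the value at the critical
    -- point is at least 0.
    rw [fbar_eq] at hfb
    have := mul_nonpos_of_nonneg_of_nonpos (sq_nonneg (ricciRoot x c + (T₁ + T₂ + T₃) / 3))
      (show 2 * ricciRoot x c - (T₁ + T₂ + T₃) / 3 ≤ 0 by linarith)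
    linarith

end Cases

end SO3
end

theorem mainTheorem1 (T : SO3.TensorField) (hT : SO3.IsLeftInvariant T) :
    ((∃ (g : SO3.TensorField) (c : ℝ), SO3.IsSolution T g c) ↔
      ∃ (V : Module.Basis (Fin 3) ℝ SO3.LieAlg) (T₁ T₂ T₃ : ℝ),
        SO3.IsMilnorBasis ![2, 2, 2] V ∧ SO3.IsDiagonalIn T V ![T₁, T₂, T₃] ∧
        (SO3.CaseI T₁ T₂ T₃ ∨ SO3.CaseII T₁ T₂ T₃ ∨ SO3.CaseIII T₁ T₂ T₃)) ∧
    (∀ (V : Module.Basis (Fin 3) ℝ SO3.LieAlg) (T₁ T₂ T₃ : ℝ),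
      SO3.IsMilnorBasis ![2, 2, 2] V → SO3.IsDiagonalIn T V ![T₁, T₂, T₃] →
        (SO3.CaseI T₁ T₂ T₃ → SO3.HasUniqueSolution T) ∧
        (SO3.CaseII T₁ T₂ T₃ → SO3.HasInfinitelyManySolutionsWith T (8 / T₁)) ∧
        (SO3.CaseIII T₁ T₂ T₃ → ¬ SO3.Exceptional T₁ T₂ T₃ → SO3.HasUniqueSolution T) ∧
        (SO3.CaseIII T₁ T₂ T₃ → SO3.Exceptional T₁ T₂ T₃ → SO3.HasExactlyTwoSolutions T)) := by
  refine ⟨⟨?_, ?_⟩, fun V T₁ T₂ T₃ hV hTV =>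
    ⟨fun h => h.hasUniqueSolution hT hV hTV, fun h => h.hasInfinitelyManySolutions hT hV hTV,
      fun h hn => h.hasUniqueSolution hn hT hV hTV,
      fun h hx => h.hasExactlyTwoSolutions hx hT hV hTV⟩⟩
  · rintro ⟨g, c, h⟩
    obtain ⟨W, x, t, hW, _, hTW, _⟩ := h.exists_diagonal
    obtain ⟨V, T₁, T₂, T₃, hV, hTV, h12, h23⟩ := SO3.exists_milnor_antitone hW hTW
    exact ⟨V, T₁, T₂, T₃, hV, hTV, h.cases hV hTV h12 h23⟩
  · rintro ⟨V, T₁, T₂, T₃, hV, hTV, h | h | h⟩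
    · obtain ⟨g, c, hs, _⟩ := h.hasUniqueSolution hT hV hTV
      exact ⟨g, c, hs⟩
    · obtain ⟨⟨G, hG, _⟩, _⟩ := h.hasInfinitelyManySolutions hT hV hTV
      exact ⟨G 0, _, hG 0⟩
    · by_cases hx : SO3.Exceptional T₁ T₂ T₃
      · obtain ⟨g, c, _, _, hs, _⟩ := h.hasExactlyTwoSolutions hx hT hV hTV
        exact ⟨g, c, hs⟩
      · obtain ⟨g, c, hs, _⟩ := h.hasUniqueSolution hx hT hV hTV
        exact ⟨g, c, hs⟩
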